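/- Let $d\ge 1$ be an integer, $1<p<\infty$, and let $H=L^2(\mathbb R^d)$ (real-valued functions) with its scalar product $(\cdot,\cdot)_2$. For a function $u$ and a vector field $F$, let $\nabla u$ and $\operatorname{div}F$ be taken in the sense of distributions on $\mathbb R^d$; "$\nabla u\in L^p$" means that the distribution $\nabla u$ is given by a vector field in $L^p(\mathbb R^d;\mathbb R^d)$, and similarly for "$\operatorname{div}F\in L^2$". Put $|z|^{p-2}z=0$ for $z=0$. Define the operator $A:D(A)\subset H\to H$ by $$Au=-\operatorname{div}(|\nabla u|^{p-2}\nabla u),\ u\in D(A),\qquad D(A)=\{u\in L^2:\ \nabla u\in L^p,\ \operatorname{div}(|\nabla u|^{p-2}\nabla u)\in L^2\},$$ and the function $\Phi:H\to\,]-\infty,+\infty]$ by $$\Phi(u)=\frac1p\int_{\mathbb R^d}|\nabla u(x)|^p\,dx\ \text{ if }\nabla u\in L^p,\qquad \Phi(u)=+\infty\ \text{ otherwise.}$$ Then: (i) $A$ is maximal monotone in $H\times H$: $(Au-Av,u-v)_2\ge 0$ for all $u,v\in D(A)$, and the graph of $A$ is not properly contained in the graph of any monotone (possibly multivalued) operator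 in $H$. Also, $A$ is $m$-accretive: $A$ is monotone (that is, accretive), and $I+\lambda A$ maps $D(A)$ onto $H$ for every $\lambda>0$. (ii) $\Phi$ is convex and lower semicontinuous on $H$. (iii) $A=\partial\Phi$, where $\partial\Phi(u)=\{w\in H:\ \Phi(u)\le\Phi(v)+(w,u-v)_2\ \ \forall v\in H\}$. That is, $\partial\Phi(u)=\{Au\}$ for $u\in D(A)$, and $\partial\Phi(u)=\emptyset$ for $u\in H\setminus D(A)$. -/

import Mathlib

open MeasureTheory
open scoped Gradient ContDiff

noncomputable section

namespace PLaplace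

/-! ### Operators and functionals on a real Hilbert space

A (possibly multivalued, possibly not everywhere defined) operator in `H` is a map `A : H → Set H`;
its domain is `{u | (A u).Nonempty}` and its graph is `{(u, w) | w ∈ A u}`. -/

section Abstract

variable {H : Type*} [NormedAddCommGroup H] [InnerProductSpace ℝ H]

/-- Monotone (in a Hilbert space: accretive) operators. -/
def IsMonotone (A : H → Set H) : Prop :=
  ∀ u v : H, ∀ w ∈ A u, ∀ z ∈ A v, 0 ≤ inner ℝ (w - z) (u - v)

/-- `A` is monotone and its graph is not properly contained in the graph of a monotone operator. -/
def IsMaximalMonotone (A : H → Set H) : Prop :=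
  IsMonotone A ∧ ∀ B : H → Set H, IsMonotone B → (∀ u, A u ⊆ B u) → B = A

/-- `A` is accretive and `I + lam A` is onto `H` for every `lam > 0`. -/
def IsMAccretive (A : H → Set H) : Prop :=
  IsMonotone A ∧ ∀ lam : ℝ, 0 < lam → ∀ f : H, ∃ u : H, ∃ w ∈ A u, u + lam • w = f

/-- Convexity of a functional with values in `]-∞, +∞]`. -/
def IsConvex (Φ : H → EReal) : Prop :=
  ∀ u v : H, ∀ a b : ℝ, 0 < a → 0 < b → a + b = 1 →
    Φ (a • u + b • v) ≤ (a : EReal) * Φ u + (b : EReal) * Φ v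

/-- The subdifferential `∂Φ(u) = {w | Φ(u) ≤ Φ(v) + (w, u - v) for all v}`. -/
def subdifferential (Φ : H → EReal) (u : H) : Set H :=
  {w | ∀ v : H, Φ u ≤ Φ v + ((inner ℝ w (u - v) : ℝ) : EReal)}

end Abstract

/-! ### Distributional gradient and divergence on `ℝ^d` -/

/-- The Euclidean space `ℝ^d`. -/
abbrev Rd (d : ℕ) : Type := EuclideanSpace ℝ (Fin d)

/-- The Hilbert space `L²(ℝ^d)` of real-valued functions. -/
abbrev L2 (d : ℕ) : Type := Lp ℝ 2 (volume : Measure (Rd d))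

/-- The distributional gradient of the locally integrable function `u` is (the regular distribution
given by) the locally integrable vector field `g`. -/
def HasWeakGradient {d : ℕ} (u : Rd d → ℝ) (g : Rd d → Rd d) : Prop :=
  LocallyIntegrable u volume ∧ LocallyIntegrable g volume ∧
    ∀ φ : Rd d → ℝ, ContDiff ℝ ∞ φ → HasCompactSupport φ →
      ∫ x, u x • ∇ φ x = -∫ x, φ x • g x

/-- The distributional divergence of the locally integrable vector field `F` is (the regular
distribution given by) the locally integrable function `w`. -/
def HasWeakDivergence {d : ℕ} (F : Rd d → Rd d) (w : Rd d → ℝ) : Prop :=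
  LocallyIntegrable F volume ∧ LocallyIntegrable w volume ∧
    ∀ φ : Rd d → ℝ, ContDiff ℝ ∞ φ → HasCompactSupport φ →
      ∫ x, inner ℝ (F x) (∇ φ x) = -∫ x, φ x • w x

/-- The weak gradient is unique up to null sets, so `weakGrad` below is well defined. -/
theorem HasWeakGradient.ae_eq {d : ℕ} {u : Rd d → ℝ} {g h : Rd d → Rd d}
    (hg : HasWeakGradient u g) (hh : HasWeakGradient u h) : g =ᵐ[volume] h :=
  ae_eq_of_integral_contDiff_smul_eq hg.2.1 hh.2.1 fun φ h1 h2 =>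
    neg_injective ((hg.2.2 φ h1 h2).symm.trans (hh.2.2 φ h1 h2))

/-- The weak divergence is unique up to null sets, so `pLaplacian` below is well defined. -/
theorem HasWeakDivergence.ae_eq {d : ℕ} {F : Rd d → Rd d} {w z : Rd d → ℝ}
    (hw : HasWeakDivergence F w) (hz : HasWeakDivergence F z) : w =ᵐ[volume] z :=
  ae_eq_of_integral_contDiff_smul_eq hw.2.1 hz.2.1 fun φ h1 h2 =>
    neg_injective ((hw.2.2 φ h1 h2).symm.trans (hz.2.2 φ h1 h2))

open Classical in
/-- The weak gradient `∇u` (a representative of it; it is `0` when the distributional gradient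
of `u` is not a locally integrable function, a case that is never used). -/
def weakGrad {d : ℕ} (u : Rd d → ℝ) : Rd d → Rd d :=
  if h : ∃ g, HasWeakGradient u g then h.choose else 0

/-- `∇u ∈ L^p`: the distributional gradient of `u` is a function, and this function lies
in `L^p`. -/
def GradMemLp {d : ℕ} (p : ℝ) (u : Rd d → ℝ) : Prop :=
  HasWeakGradient u (weakGrad u) ∧ MemLp (weakGrad u) (ENNReal.ofReal p) volume

/-! ### The `p`-Laplace operator and its potential -/

/-- The vector field `|∇u|^{p-2} ∇u` (equal to `0` where `∇u = 0`). -/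
def flux {d : ℕ} (p : ℝ) (u : Rd d → ℝ) : Rd d → Rd d :=
  fun x => ‖weakGrad u x‖ ^ (p - 2) • weakGrad u x

/-- `D(A) = {u ∈ L² | ∇u ∈ L^p, div(|∇u|^{p-2} ∇u) ∈ L²}`. -/
def pLaplaceDomain (d : ℕ) (p : ℝ) : Set (L2 d) :=
  {u | GradMemLp p u ∧ ∃ w : L2 d, HasWeakDivergence (flux p u) w}

/-- `A u = -div(|∇u|^{p-2} ∇u)` for `u ∈ D(A)`. -/
def pLaplacian {d : ℕ} {p : ℝ} (u : pLaplaceDomain d p) : L2 d :=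
  -u.2.2.choose

/-- The operator `A : D(A) ⊂ L² → L²`, regarded as an operator `L² → Set L²`:
`{A u}` for `u ∈ D(A)` and `∅` otherwise. -/
def pLaplaceOp (d : ℕ) (p : ℝ) (u : L2 d) : Set (L2 d) :=
  {w | ∃ hu : u ∈ pLaplaceDomain d p, w = pLaplacian ⟨u, hu⟩}

open Classical in
/-- `Φ(u) = (1/p) ∫ |∇u|^p` if `|∇u| ∈ L^p`, and `Φ(u) = +∞` otherwise. -/
def potential (d : ℕ) (p : ℝ) (u : L2 d) : EReal :=
  if GradMemLp p u then (((1 / p) * ∫ x, ‖weakGrad u x‖ ^ p : ℝ) : EReal) else ⊤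

end PLaplace

end

open MeasureTheory
open scoped Gradient ContDiff

noncomputable section

namespace PLaplace

open Filter Topology
open scoped ENNReal Convolution Pointwise

/-! ### Convex functionals, subdifferentials and resolvents in a Hilbert space. -/

section AbstractTheory

variable {H : Type*} [NormedAddCommGroup H] [InnerProductSpace ℝ H]

/-! Everything follows once `A = ∂Φ` and `Φ` is known to be nonnegative, proper, convex and lower
semicontinuous: minimising `Φ + ‖· - f‖² / (2 lam)` solves `u + lam w = f` with `w ∈ ∂Φ(u)`, and
surjectivity of `I + A` makes a monotone `A` maximal.

The inclusion `A ⊆ ∂Φ` integrates the inequality `|a|^p + p (|a|^(p-2) a, b - a) ≤ |b|^p` and needs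
the integration by parts `∫ F · ∇u = -∫ u div F` for `u ∈ L²`, `∇u ∈ L^p`, `F ∈ L^{p'}`, `div F ∈
L²` (`HasWeakDivergence.integral_inner_weakGradient`). Cutting off in space would create the term `u
F · ∇ζ`, which these exponents do not control. Instead `u` is mollified, which makes it smooth and
vanishing at infinity, and its values are then truncated near zero, which makes the support compact.

The inclusion `∂Φ ⊆ A` is the Euler equation: the subgradient inequality is tested along `u ± tφ`
and `t → 0`.

Lower semicontinuity (`potential_le_of_mem_closure`) uses uniform convexity of `L^p` in place of
weak compactness: gradients of almost minimal norm, taken over functions approaching `u`, converge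
strongly, and the weak gradient is closed. -/

theorem IsMAccretive.isMaximalMonotone {A : H → Set H} (hA : IsMAccretive A) :
    IsMaximalMonotone A := by
  refine ⟨hA.1, fun B hB hAB => ?_⟩
  funext u
  refine Set.Subset.antisymm (fun z hz => ?_) (hAB u)
  -- For a new pair `(u, z)` of `B`, the solution of `v + w = u + z` satisfies `z - w = -(u - v)`,
  -- so monotonicity of `B` gives `-‖u - v‖² ≥ 0`.
  obtain ⟨v, w, hw, hvw⟩ := hA.2 1 one_pos (u + z)
  rw [one_smul] at hvw
  have h := hB u v z hz w (hAB v hw)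
  have hzw : z - w = -(u - v) := by
    rw [neg_sub, sub_eq_sub_iff_add_eq_add, add_comm z u, hvw]
  rw [hzw, inner_neg_left, real_inner_self_eq_norm_sq] at h
  have huv : u = v := by
    have : ‖u - v‖ ^ 2 = 0 := le_antisymm (by linarith) (sq_nonneg _)
    simpa [sub_eq_zero] using this
  have : z = w := by rw [huv, sub_self, neg_zero, sub_eq_zero] at hzw; exact hzw
  rw [huv, this]; exact hw

theorem ne_top_of_mem_subdifferential {Φ : H → EReal} (htop : ∃ u, Φ u ≠ ⊤) {u w : H}
    (hw : w ∈ subdifferential Φ u) : Φ u ≠ ⊤ := by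
  obtain ⟨v, hv⟩ := htop
  exact ne_of_lt (lt_of_le_of_lt (hw v) (EReal.add_lt_top hv (EReal.coe_ne_top _)))

theorem subdifferential_isMonotone {Φ : H → EReal} (hbot : ∀ u, Φ u ≠ ⊥) (htop : ∃ u, Φ u ≠ ⊤) :
    IsMonotone (subdifferential Φ) := by
  intro u v w hw z hz
  have hu := ne_top_of_mem_subdifferential htop hw
  have hv := ne_top_of_mem_subdifferential htop hz
  have h1 := hw v
  have h2 := hz u
  rw [← EReal.coe_toReal hu (hbot u), ← EReal.coe_toReal hv (hbot v), ← EReal.coe_add,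
    EReal.coe_le_coe_iff] at h1 h2
  have : inner ℝ (w - z) (u - v) = inner ℝ w (u - v) + inner ℝ z (v - u) := by
    rw [inner_sub_left, ← neg_sub u v, inner_neg_right]; ring
  rw [this]; linarith

/-- The parallelogram law centred at `f`. The term `‖a - b‖² / 4` is the convexity gain that makes
minimising sequences Cauchy. -/
theorem norm_midpoint_sub_sq (a b f : H) :
    ‖(1 / 2 : ℝ) • a + (1 / 2 : ℝ) • b - f‖ ^ 2 =
      (‖a - f‖ ^ 2 + ‖b - f‖ ^ 2) / 2 - ‖a - b‖ ^ 2 / 4 := by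
  have h1 : (1 / 2 : ℝ) • a + (1 / 2 : ℝ) • b - f = (1 / 2 : ℝ) • ((a - f) + (b - f)) := by
    module
  have h2 := parallelogram_law_with_norm ℝ (a - f) (b - f)
  rw [sub_sub_sub_cancel_right] at h2
  rw [h1, norm_smul, mul_pow]
  norm_num
  nlinarith

/-- A strongly convex perturbation of a proper, convex, lower semicontinuous, nonnegative
functional attains its minimum. -/
theorem exists_minimizer_add_norm_sq [CompleteSpace H] {Φ : H → EReal} (h0 : ∀ u, 0 ≤ Φ u)
    (htop : ∃ u, Φ u ≠ ⊤) (hconv : IsConvex Φ) (hlsc : LowerSemicontinuous Φ) {c : ℝ} (hc : 0 < c)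
    (f : H) : ∃ u, Φ u ≠ ⊤ ∧ ∀ v, Φ v ≠ ⊤ →
      (Φ u).toReal + c * ‖u - f‖ ^ 2 ≤ (Φ v).toReal + c * ‖v - f‖ ^ 2 := by
  have hbot : ∀ u, Φ u ≠ ⊥ := fun u => ne_bot_of_le_ne_bot EReal.zero_ne_bot (h0 u)
  have hr0 : ∀ u, 0 ≤ (Φ u).toReal := fun u => EReal.toReal_nonneg (h0 u)
  set J : H → ℝ := fun v => (Φ v).toReal + c * ‖v - f‖ ^ 2 with hJ
  have hJ0 : ∀ v, 0 ≤ J v := fun v => add_nonneg (hr0 v) (by positivity)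
  set S : Set ℝ := J '' {v | Φ v ≠ ⊤} with hS
  have hSne : S.Nonempty := Set.Nonempty.image _ htop
  have hSbdd : BddBelow S := ⟨0, by rintro _ ⟨v, -, rfl⟩; exact hJ0 v⟩
  set m := sInf S with hm
  have hmle : ∀ v, Φ v ≠ ⊤ → m ≤ J v := fun v hv => csInf_le hSbdd ⟨v, hv, rfl⟩
  have hex : ∀ n : ℕ, ∃ v, Φ v ≠ ⊤ ∧ J v < m + 1 / ((n : ℝ) + 1) := by
    intro n
    obtain ⟨_, ⟨v, hv, rfl⟩, hlt⟩ := exists_lt_of_csInf_lt hSne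
      (lt_add_of_pos_right m (Nat.one_div_pos_of_nat (n := n) (α := ℝ)))
    exact ⟨v, hv, hlt⟩
  choose v hv hvlt using hex
  -- The midpoint is itself a competitor, so `J` is at least `m` there; the parallelogram term then
  -- controls the distance.
  have hmid : ∀ a b, Φ a ≠ ⊤ → Φ b ≠ ⊤ → c / 4 * ‖a - b‖ ^ 2 ≤ (J a + J b) / 2 - m := by
    intro a b ha hb
    have h1 := hconv a b (1 / 2) (1 / 2) (by norm_num) (by norm_num) (by norm_num)
    rw [← EReal.coe_toReal ha (hbot a), ← EReal.coe_toReal hb (hbot b), ← EReal.coe_mul,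
      ← EReal.coe_mul, ← EReal.coe_add] at h1
    have h2 : Φ ((1 / 2 : ℝ) • a + (1 / 2 : ℝ) • b) ≠ ⊤ :=
      ne_of_lt (h1.trans_lt (EReal.coe_lt_top _))
    rw [← EReal.coe_toReal h2 (hbot _), EReal.coe_le_coe_iff] at h1
    have h3 := hmle _ h2
    simp only [hJ, norm_midpoint_sub_sq] at h3 ⊢
    nlinarith
  have hlim : Tendsto (fun n : ℕ => 1 / ((n : ℝ) + 1)) atTop (𝓝 0) :=
    tendsto_one_div_add_atTop_nhds_zero_nat
  have hcau : CauchySeq v := by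
    rw [Metric.cauchySeq_iff]
    intro ε hε
    obtain ⟨N, hN⟩ := (hlim.eventually (gt_mem_nhds (show 0 < c / 4 * ε ^ 2 by positivity))).exists
    refine ⟨N, fun k hk l hl => ?_⟩
    have hmono : ∀ k, N ≤ k → J (v k) < m + c / 4 * ε ^ 2 := fun k hk =>
      (hvlt k).trans (by have := Nat.one_div_le_one_div (α := ℝ) hk; linarith)
    have := hmid _ _ (hv k) (hv l)
    have hk' := hmono k hk
    have hl' := hmono l hl
    rw [dist_eq_norm]
    have h4 : c / 4 * ‖v k - v l‖ ^ 2 < c / 4 * ε ^ 2 := by linarith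
    exact lt_of_pow_lt_pow_left₀ 2 hε.le (lt_of_mul_lt_mul_left h4 (by positivity))
  obtain ⟨u, hu⟩ := cauchySeq_tendsto_of_complete hcau
  -- The norm term converges along `v`, so `v n` eventually lies in this closed sublevel set of `Φ`;
  -- the slack `ε` absorbs both errors.
  have hkey : ∀ ε : ℝ, 0 < ε → Φ u ≤ ((m - c * ‖u - f‖ ^ 2 + ε : ℝ) : EReal) := by
    intro ε hε
    have hcl : IsClosed {x | Φ x ≤ ((m - c * ‖u - f‖ ^ 2 + ε : ℝ) : EReal)} :=
      lowerSemicontinuous_iff_isClosed_preimage.1 hlsc _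
    refine hcl.mem_of_tendsto hu ?_
    have ht : Tendsto (fun n : ℕ => m + 1 / ((n : ℝ) + 1) - c * ‖v n - f‖ ^ 2) atTop
        (𝓝 (m + 0 - c * ‖u - f‖ ^ 2)) :=
      (hlim.const_add m).sub (((hu.sub_const f).norm.pow 2).const_mul c)
    filter_upwards [ht.eventually (gt_mem_nhds (show m + 0 - c * ‖u - f‖ ^ 2 <
      m - c * ‖u - f‖ ^ 2 + ε by linarith))] with n hn
    rw [← EReal.coe_toReal (hv n) (hbot _), EReal.coe_le_coe_iff]
    have := hvlt n
    simp only [hJ] at this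
    linarith
  have hutop : Φ u ≠ ⊤ := ne_of_lt ((hkey 1 one_pos).trans_lt (EReal.coe_lt_top _))
  refine ⟨u, hutop, fun x hx => ?_⟩
  have : J u ≤ m := by
    refine le_of_forall_pos_le_add fun ε hε => ?_
    have := hkey ε hε
    rw [← EReal.coe_toReal hutop (hbot _), EReal.coe_le_coe_iff] at this
    simp only [hJ]; linarith
  exact this.trans (hmle x hx)

theorem exists_mem_subdifferential_add_smul_eq [CompleteSpace H] {Φ : H → EReal}
    (h0 : ∀ u, 0 ≤ Φ u) (htop : ∃ u, Φ u ≠ ⊤) (hconv : IsConvex Φ) (hlsc : LowerSemicontinuous Φ)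
    {lam : ℝ} (hlam : 0 < lam) (f : H) : ∃ u, ∃ w ∈ subdifferential Φ u, u + lam • w = f := by
  have hbot : ∀ u, Φ u ≠ ⊥ := fun u => ne_bot_of_le_ne_bot EReal.zero_ne_bot (h0 u)
  obtain ⟨u, hu, hmin⟩ := exists_minimizer_add_norm_sq h0 htop hconv hlsc
    (show 0 < 1 / (2 * lam) by positivity) f
  refine ⟨u, lam⁻¹ • (f - u), fun v => ?_, by rw [smul_inv_smul₀ hlam.ne']; abel⟩
  by_cases hv : Φ v = ⊤
  · rw [hv, EReal.top_add_coe]; exact le_top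
  rw [← EReal.coe_toReal hu (hbot _), ← EReal.coe_toReal hv (hbot _), ← EReal.coe_add,
    EReal.coe_le_coe_iff]
  -- Minimality of `u` against `u + t (v - u)`, divided by `t`; only the quadratic remainder keeps a
  -- factor `t`.
  have key : ∀ t : ℝ, 0 < t → t < 1 → (Φ u).toReal ≤
      (Φ v).toReal + inner ℝ (lam⁻¹ • (f - u)) (u - v) + t * (1 / (2 * lam) * ‖v - u‖ ^ 2) := by
    intro t ht ht1
    have h1 := hconv u v (1 - t) t (by linarith) ht (by ring)
    rw [← EReal.coe_toReal hu (hbot _), ← EReal.coe_toReal hv (hbot _), ← EReal.coe_mul,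
      ← EReal.coe_mul, ← EReal.coe_add] at h1
    have h2 : Φ ((1 - t) • u + t • v) ≠ ⊤ := ne_of_lt (h1.trans_lt (EReal.coe_lt_top _))
    rw [← EReal.coe_toReal h2 (hbot _), EReal.coe_le_coe_iff] at h1
    have h3 := hmin _ h2
    have h4 : (1 - t) • u + t • v - f = (u - f) + t • (v - u) := by module
    rw [h4, norm_add_sq_real, norm_smul, real_inner_smul_right, Real.norm_of_nonneg ht.le] at h3
    have h5 : inner ℝ (lam⁻¹ • (f - u)) (u - v) = lam⁻¹ * inner ℝ (u - f) (v - u) := by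
      rw [real_inner_smul_left, ← neg_sub u f, ← neg_sub v u, inner_neg_neg]
    rw [h5]
    have h6 : t * (Φ u).toReal ≤ t * ((Φ v).toReal + lam⁻¹ * inner ℝ (u - f) (v - u) +
        t * (1 / (2 * lam) * ‖v - u‖ ^ 2)) := by
      have h7 : 1 / (2 * lam) * (‖u - f‖ ^ 2 + 2 * (t * inner ℝ (u - f) (v - u)) +
          (t * ‖v - u‖) ^ 2) = 1 / (2 * lam) * ‖u - f‖ ^ 2 + t * (lam⁻¹ * inner ℝ (u - f) (v - u))
          + t * (t * (1 / (2 * lam) * ‖v - u‖ ^ 2)) := by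
        field_simp
      rw [h7] at h3
      linarith
    exact le_of_mul_le_mul_left h6 ht
  have hlim : Tendsto (fun t : ℝ => (Φ v).toReal + inner ℝ (lam⁻¹ • (f - u)) (u - v) +
      t * (1 / (2 * lam) * ‖v - u‖ ^ 2)) (𝓝[>] 0) (𝓝 ((Φ v).toReal +
        inner ℝ (lam⁻¹ • (f - u)) (u - v) + 0 * (1 / (2 * lam) * ‖v - u‖ ^ 2))) :=
    ((tendsto_id.mul_const _).const_add _).mono_left nhdsWithin_le_nhds
  rw [zero_mul, add_zero] at hlim
  refine ge_of_tendsto hlim ?_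
  filter_upwards [Ioo_mem_nhdsGT (zero_lt_one' ℝ)] with t ht using key t ht.1 ht.2

end AbstractTheory

/-! ### Convexity inequalities for `‖·‖ ^ p`, and uniform convexity. -/

section Pointwise

theorem norm_smul_add_smul_rpow_le {E : Type*} [NormedAddCommGroup E] [NormedSpace ℝ E] {p : ℝ}
    (hp : 1 ≤ p) (x y : E) {a b : ℝ} (ha : 0 ≤ a) (hb : 0 ≤ b) (hab : a + b = 1) :
    ‖a • x + b • y‖ ^ p ≤ a * ‖x‖ ^ p + b * ‖y‖ ^ p := by
  have h1 : ‖a • x + b • y‖ ≤ a * ‖x‖ + b * ‖y‖ := by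
    refine (norm_add_le _ _).trans (le_of_eq ?_)
    rw [norm_smul, norm_smul, Real.norm_of_nonneg ha, Real.norm_of_nonneg hb]
  have h2 := (convexOn_rpow hp).2 (Set.mem_Ici.2 (norm_nonneg x)) (Set.mem_Ici.2 (norm_nonneg y))
    ha hb hab
  simp only [smul_eq_mul] at h2
  exact (Real.rpow_le_rpow (norm_nonneg _) h1 (by linarith)).trans h2

theorem norm_midpoint_rpow_le {E : Type*} [NormedAddCommGroup E] [NormedSpace ℝ E] {p : ℝ}
    (hp : 1 ≤ p) (x y : E) :
    ‖(1 / 2 : ℝ) • x + (1 / 2 : ℝ) • y‖ ^ p ≤ (‖x‖ ^ p + ‖y‖ ^ p) / 2 :=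
  (norm_smul_add_smul_rpow_le hp x y (by norm_num) (by norm_num) (by norm_num)).trans_eq (by ring)

variable {E : Type*} [NormedAddCommGroup E] [InnerProductSpace ℝ E]

/-- At `z = 0` the real power `‖z‖ ^ (p - 2)` is only a default value (`1` if `p = 2`, else `0`),
harmless because it multiplies `z`. Since `p - 1 > 0`, this formula also gives continuity at the
origin when `p < 2`. -/
theorem norm_rpow_sub_two_smul {p : ℝ} (hp : 1 < p) (z : E) :
    ‖‖z‖ ^ (p - 2) • z‖ = ‖z‖ ^ (p - 1) := by
  rcases eq_or_ne z 0 with rfl | hz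
  · rw [smul_zero, norm_zero, Real.zero_rpow (by linarith)]
  · rw [norm_smul, Real.norm_of_nonneg (by positivity),
      ← Real.rpow_add_one (norm_ne_zero_iff.2 hz)]
    congr 1; ring

theorem continuous_norm_rpow_sub_two_smul {p : ℝ} (hp : 1 < p) :
    Continuous fun z : E => ‖z‖ ^ (p - 2) • z := by
  rw [continuous_iff_continuousAt]
  intro z
  rcases eq_or_ne z 0 with rfl | hz
  · rw [ContinuousAt, smul_zero, tendsto_zero_iff_norm_tendsto_zero]
    simp_rw [norm_rpow_sub_two_smul hp]
    have : ContinuousAt (fun z : E => ‖z‖ ^ (p - 1)) 0 :=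
      continuousAt_id.norm.rpow_const (Or.inr (by linarith))
    simpa [ContinuousAt, Real.zero_rpow (show p - 1 ≠ 0 by linarith)] using this
  · exact (continuousAt_id.norm.rpow_const (Or.inl (norm_ne_zero_iff.2 hz))).smul continuousAt_id

theorem rpow_sub_one_mul_self {p : ℝ} (hp : 1 < p) {x : ℝ} (hx : 0 ≤ x) :
    x ^ (p - 1) * x = x ^ p := by
  rcases hx.eq_or_lt with rfl | hx
  · rw [mul_zero, Real.zero_rpow (by linarith)]
  · rw [← Real.rpow_add_one hx.ne', sub_add_cancel]

theorem inner_norm_rpow_sub_two_smul_self {p : ℝ} (hp : 1 < p) (z : E) :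
    inner ℝ (‖z‖ ^ (p - 2) • z) z = ‖z‖ ^ p := by
  rcases eq_or_ne z 0 with rfl | hz
  · rw [inner_zero_right, norm_zero, Real.zero_rpow (by linarith)]
  · rw [real_inner_smul_left, real_inner_self_eq_norm_sq, ← Real.rpow_natCast,
      ← Real.rpow_add (norm_pos_iff.2 hz)]
    congr 1; push_cast; ring

/-- Cauchy–Schwarz reduces the claim to Young's inequality for `‖b‖` and `‖a‖ ^ (p - 1)` with
exponents `p` and `p / (p - 1)`; no differentiation is needed. -/
theorem norm_rpow_add_mul_inner_le {p : ℝ} (hp : 1 < p) (a b : E) :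
    ‖a‖ ^ p + p * inner ℝ (‖a‖ ^ (p - 2) • a) (b - a) ≤ ‖b‖ ^ p := by
  have hp0 : 0 < p := by linarith
  rw [inner_sub_right, inner_norm_rpow_sub_two_smul_self hp]
  have h1 : inner ℝ (‖a‖ ^ (p - 2) • a) b ≤ ‖a‖ ^ (p - 1) * ‖b‖ := by
    refine (real_inner_le_norm _ _).trans ?_
    rw [norm_rpow_sub_two_smul hp]
  have hpq : p.HolderConjugate (p / (p - 1)) := Real.HolderConjugate.conjExponent hp
  have h2 := Real.young_inequality_of_nonneg (norm_nonneg b)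
    (Real.rpow_nonneg (norm_nonneg a) (p - 1)) hpq
  rw [← Real.rpow_mul (norm_nonneg a), mul_div_cancel₀ _ (by linarith : p - 1 ≠ 0)] at h2
  have h3 : p * (‖b‖ * ‖a‖ ^ (p - 1)) ≤ ‖b‖ ^ p + (p - 1) * ‖a‖ ^ p := by
    have := mul_le_mul_of_nonneg_left h2 hp0.le
    refine this.trans (le_of_eq ?_)
    have : p - 1 ≠ 0 := by linarith
    field_simp
  have h4 := mul_le_mul_of_nonneg_left h1 hp0.le
  rw [mul_comm ‖b‖] at h3
  linarith

/-- For equal norms the strictness comes from the parallelogram law, for different norms from strict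
convexity of the real power. -/
theorem norm_midpoint_rpow_lt {p : ℝ} (hp : 1 < p) {a b : E} (hab : a ≠ b) :
    ‖(1 / 2 : ℝ) • a + (1 / 2 : ℝ) • b‖ ^ p < (‖a‖ ^ p + ‖b‖ ^ p) / 2 := by
  have hp0 : 0 < p := by linarith
  by_cases h : ‖a‖ = ‖b‖
  · have h1 : ‖(1 / 2 : ℝ) • a + (1 / 2 : ℝ) • b‖ ^ 2 < ‖a‖ ^ 2 := by
      have := norm_midpoint_sub_sq a b 0
      simp only [sub_zero] at this
      rw [this, ← h]
      have : 0 < ‖a - b‖ ^ 2 := by have := norm_pos_iff.2 (sub_ne_zero.2 hab); positivity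
      linarith
    have h2 := Real.rpow_lt_rpow (norm_nonneg _) (lt_of_pow_lt_pow_left₀ 2 (norm_nonneg _) h1) hp0
    rw [← h]; linarith
  · have h1 := (strictConvexOn_rpow hp).2 (Set.mem_Ici.2 (norm_nonneg a))
      (Set.mem_Ici.2 (norm_nonneg b)) h (show (0 : ℝ) < 1 / 2 by norm_num)
      (show (0 : ℝ) < 1 / 2 by norm_num) (by norm_num)
    simp only [smul_eq_mul] at h1
    have h2 : ‖(1 / 2 : ℝ) • a + (1 / 2 : ℝ) • b‖ ≤ 1 / 2 * ‖a‖ + 1 / 2 * ‖b‖ := by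
      refine (norm_add_le _ _).trans (le_of_eq ?_)
      simp [norm_smul]
    have h3 := Real.rpow_le_rpow (norm_nonneg _) h2 hp0.le
    linarith

/-- A quantitative form of the strict convexity of `‖·‖ ^ p`, obtained by compactness. -/
theorem exists_norm_sub_rpow_le [FiniteDimensional ℝ E] {p : ℝ} (hp : 1 < p) {ε : ℝ} (hε : 0 < ε) :
    ∃ C : ℝ, 0 ≤ C ∧ ∀ a b : E, ‖a - b‖ ^ p ≤ ε * (‖a‖ ^ p + ‖b‖ ^ p) +
      C * ((‖a‖ ^ p + ‖b‖ ^ p) / 2 - ‖(1 / 2 : ℝ) • a + (1 / 2 : ℝ) • b‖ ^ p) := by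
  have hp0 : 0 < p := by linarith
  have hcr : ∀ {f : E × E → E}, Continuous f → Continuous fun x => ‖f x‖ ^ p := fun hf =>
    hf.norm.rpow_const fun _ => Or.inr hp0.le
  set s : E × E → ℝ := fun x => ‖x.1‖ ^ p + ‖x.2‖ ^ p with hs
  set g : E × E → ℝ := fun x => s x / 2 - ‖(1 / 2 : ℝ) • x.1 + (1 / 2 : ℝ) • x.2‖ ^ p with hg
  set k : E × E → ℝ := fun x => ‖x.1 - x.2‖ ^ p with hk
  have hsc : Continuous s := (hcr continuous_fst).add (hcr continuous_snd)
  have hkc : Continuous k := hcr (continuous_fst.sub continuous_snd)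
  have hgc : Continuous g := (hsc.div_const _).sub
    (hcr ((continuous_fst.const_smul _).add (continuous_snd.const_smul _)))
  have hg0 : ∀ x, 0 ≤ g x := fun x => sub_nonneg.2 (norm_midpoint_rpow_le hp.le _ _)
  have hle1 : ∀ z : E, ‖z‖ ^ p ≤ 1 → ‖z‖ ≤ 1 := fun z hz => by
    rwa [← Real.one_rpow p, Real.rpow_le_rpow_iff (norm_nonneg _) zero_le_one hp0] at hz
  have hScomp : IsCompact {x | s x = 1} := by
    refine Metric.isCompact_of_isClosed_isBounded (isClosed_eq hsc continuous_const)
      (Metric.isBounded_closedBall (x := (0 : E × E)) (r := 1) |>.subset fun x hx => ?_)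
    rw [mem_closedBall_zero_iff, Prod.norm_def]
    have h1 : 0 ≤ ‖x.1‖ ^ p := by positivity
    have h2 : 0 ≤ ‖x.2‖ ^ p := by positivity
    have h3 : ‖x.1‖ ^ p + ‖x.2‖ ^ p = 1 := hx
    exact max_le (hle1 _ (by linarith)) (hle1 _ (by linarith))
  have hKcomp : IsCompact ({x | s x = 1} ∩ {x | ε ≤ k x}) :=
    hScomp.inter_right (isClosed_le continuous_const hkc)
  -- Where `k < ε` nothing is needed. On the compact rest, `a ≠ b`, so the convexity gap `g` has a
  -- positive minimum, and `C = max k / min g` works.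
  obtain ⟨C, hC0, hC⟩ : ∃ C : ℝ, 0 ≤ C ∧ ∀ x, s x = 1 → k x ≤ ε + C * g x := by
    rcases Set.eq_empty_or_nonempty ({x | s x = 1} ∩ {x | ε ≤ k x}) with hK | hK
    · refine ⟨0, le_rfl, fun x hx => ?_⟩
      by_contra! hcon
      have : x ∈ ({x | s x = 1} ∩ {x | ε ≤ k x}) := ⟨hx, by simpa using hcon.le⟩
      rw [hK] at this; exact this
    · obtain ⟨x₀, hx₀, hmin⟩ := hKcomp.exists_isMinOn hK hgc.continuousOn
      obtain ⟨x₁, hx₁, hmax⟩ := hKcomp.exists_isMaxOn hK hkc.continuousOn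
      have hk0 : ∀ x, 0 ≤ k x := fun x => Real.rpow_nonneg (norm_nonneg _) _
      have hgpos : 0 < g x₀ := by
        refine sub_pos.2 (norm_midpoint_rpow_lt hp fun h => ?_)
        have : ε ≤ k x₀ := hx₀.2
        simp only [hk, h, sub_self, norm_zero, Real.zero_rpow hp0.ne'] at this
        linarith
      refine ⟨k x₁ / g x₀, div_nonneg (hk0 _) hgpos.le, fun x hx => ?_⟩
      by_cases hxk : ε ≤ k x
      · have h1 : k x ≤ k x₁ := hmax ⟨hx, hxk⟩
        have h2 : g x₀ ≤ g x := hmin ⟨hx, hxk⟩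
        have h3 : k x₁ ≤ k x₁ / g x₀ * g x := by
          rw [div_mul_eq_mul_div, le_div_iff₀ hgpos]
          exact mul_le_mul_of_nonneg_left h2 (hk0 _)
        linarith
      · have := mul_nonneg (div_nonneg (hk0 x₁) hgpos.le) (hg0 x)
        linarith [not_le.1 hxk]
  refine ⟨C, hC0, fun a b => ?_⟩
  have hs0 : 0 ≤ s (a, b) := by simp only [hs]; positivity
  rcases hs0.eq_or_lt with h0 | hpos
  · have h1 : 0 ≤ ‖a‖ ^ p := by positivity
    have h2 : 0 ≤ ‖b‖ ^ p := by positivity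
    have h3 : ‖a‖ ^ p + ‖b‖ ^ p = 0 := h0.symm
    have ha : a = 0 := by
      have := (Real.rpow_eq_zero (norm_nonneg a) hp0.ne').1 (by linarith)
      simpa using this
    have hb : b = 0 := by
      have := (Real.rpow_eq_zero (norm_nonneg b) hp0.ne').1 (by linarith)
      simpa using this
    simp [ha, hb, Real.zero_rpow hp0.ne']
  -- All terms are homogeneous of degree `p`; this factor scales the pair to `s = 1`.
  · set t : ℝ := (s (a, b)) ^ (-p⁻¹) with ht
    have htpos : 0 < t := Real.rpow_pos_of_pos hpos _
    have htp : t ^ p = (s (a, b))⁻¹ := by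
      rw [ht, ← Real.rpow_mul hs0, neg_mul, inv_mul_cancel₀ hp0.ne', Real.rpow_neg_one]
    have hsm : ∀ z : E, ‖t • z‖ ^ p = (s (a, b))⁻¹ * ‖z‖ ^ p := fun z => by
      rw [norm_smul, Real.norm_of_nonneg htpos.le, Real.mul_rpow htpos.le (norm_nonneg _), htp]
    have h1 := hC (t • a, t • b) (by
      simp only [hs, hsm]; rw [← mul_add]; exact inv_mul_cancel₀ hpos.ne')
    simp only [hk, hg, hs] at h1
    rw [← smul_sub, smul_comm _ t a, smul_comm _ t b, ← smul_add, hsm, hsm, hsm, hsm] at h1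
    have h2 := mul_le_mul_of_nonneg_left h1 hs0
    rw [mul_inv_cancel_left₀ hpos.ne'] at h2
    refine h2.trans (le_of_eq ?_)
    have h3 : ‖a‖ ^ p + ‖b‖ ^ p = s (a, b) := rfl
    rw [← mul_add, h3, inv_mul_cancel₀ hpos.ne']
    field_simp

/-- In a normed space satisfying a uniform convexity condition, almost minimisers of the norm over
a decreasing sequence of bounded midpoint convex sets form a Cauchy sequence. -/
theorem exists_cauchySeq_of_midpoint_mem {E : Type*} [NormedAddCommGroup E] [NormedSpace ℝ E]
    {p : ℝ} (hp0 : 0 < p)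
    (huc : ∀ ε : ℝ, 0 < ε → ∃ C : ℝ, 0 ≤ C ∧ ∀ x y : E, ‖x - y‖ ^ p ≤ ε * (‖x‖ ^ p + ‖y‖ ^ p) +
      C * ((‖x‖ ^ p + ‖y‖ ^ p) / 2 - ‖(1 / 2 : ℝ) • x + (1 / 2 : ℝ) • y‖ ^ p))
    {T : ℕ → Set E} (hne : ∀ n, (T n).Nonempty) (hanti : Antitone T)
    (hmid : ∀ n, ∀ x ∈ T n, ∀ y ∈ T n, (1 / 2 : ℝ) • x + (1 / 2 : ℝ) • y ∈ T n) {M : ℝ}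
    (hM : ∀ n, ∀ x ∈ T n, ‖x‖ ^ p ≤ M) : ∃ z : ℕ → E, (∀ n, z n ∈ T n) ∧ CauchySeq z := by
  let r : ℕ → ℝ := fun n => 1 / ((n : ℝ) + 1)
  have hr : ∀ n, 0 < r n := fun n => Nat.one_div_pos_of_nat
  have hrlim : Tendsto r atTop (𝓝 0) := tendsto_one_div_add_atTop_nhds_zero_nat
  have hrmono : ∀ {n m}, n ≤ m → r m ≤ r n := fun h => Nat.one_div_le_one_div h
  set D : ℕ → ℝ := fun n => sInf ((fun x => ‖x‖ ^ p) '' T n) with hD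
  have hbdd : ∀ n, BddBelow ((fun x : E => ‖x‖ ^ p) '' T n) := fun n =>
    ⟨0, by rintro _ ⟨z, -, rfl⟩; exact Real.rpow_nonneg (norm_nonneg _) _⟩
  have hDle : ∀ n, ∀ x ∈ T n, D n ≤ ‖x‖ ^ p := fun n x hx => csInf_le (hbdd n) ⟨x, hx, rfl⟩
  -- The infima increase as the sets shrink and are bounded by `M`, so they converge; this forces
  -- the convexity gap to zero.
  have hDmono : Monotone D := fun n m h =>
    csInf_le_csInf (hbdd n) ((hne m).image _) (Set.image_mono (hanti h))
  have hDbdd : BddAbove (Set.range D) := by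
    refine ⟨M, ?_⟩
    rintro _ ⟨n, rfl⟩
    obtain ⟨x, hx⟩ := hne n
    exact (hDle n x hx).trans (hM n x hx)
  have hDlim := tendsto_atTop_ciSup hDmono hDbdd
  have hex : ∀ n, ∃ x ∈ T n, ‖x‖ ^ p < D n + r n := by
    intro n
    obtain ⟨_, ⟨x, hx, rfl⟩, hlt⟩ := exists_lt_of_csInf_lt ((hne n).image fun x => ‖x‖ ^ p)
      (lt_add_of_pos_right (D n) (hr n))
    exact ⟨x, hx, hlt⟩
  choose z hzT hzlt using hex
  refine ⟨z, hzT, Metric.cauchySeq_iff'.2 fun ε hε => ?_⟩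
  have hεp : 0 < ε ^ p := Real.rpow_pos_of_pos hε p
  have hM0 : 0 ≤ M := (Real.rpow_nonneg (norm_nonneg _) _).trans (hM 0 _ (hzT 0))
  -- The two powers sum to at most `2 M`, so this choice costs at most `ε ^ p / 2`; `M + 1` avoids
  -- dividing by zero.
  obtain ⟨C, hC0, hC⟩ := huc (ε ^ p / (4 * (M + 1))) (by positivity)
  have hlim : Tendsto (fun n => C * (r n + ((⨆ k, D k) - D n))) atTop (𝓝 0) := by
    have := (hrlim.add (hDlim.const_sub (⨆ k, D k))).const_mul C
    simpa using this
  obtain ⟨N, hN⟩ := (hlim.eventually (gt_mem_nhds (half_pos hεp))).exists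
  refine ⟨N, fun n hn => ?_⟩
  rw [dist_eq_norm]
  have h1 := hC (z n) (z N)
  have h2 : D N ≤ ‖(1 / 2 : ℝ) • z n + (1 / 2 : ℝ) • z N‖ ^ p :=
    hDle N _ (hmid N _ (hanti hn (hzT n)) _ (hzT N))
  have h3 : ‖z n‖ ^ p ≤ (⨆ k, D k) + r N :=
    (hzlt n).le.trans (add_le_add (le_ciSup hDbdd n) (hrmono hn))
  have h4 : ‖z N‖ ^ p ≤ (⨆ k, D k) + r N :=
    (hzlt N).le.trans (add_le_add_left (le_ciSup hDbdd N) _)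
  have h5 : ‖z n‖ ^ p ≤ M := hM n _ (hzT n)
  have h6 : ‖z N‖ ^ p ≤ M := hM N _ (hzT N)
  have h7 : C * ((‖z n‖ ^ p + ‖z N‖ ^ p) / 2 - ‖(1 / 2 : ℝ) • z n + (1 / 2 : ℝ) • z N‖ ^ p) ≤
      C * (r N + ((⨆ k, D k) - D N)) :=
    mul_le_mul_of_nonneg_left (by linarith) hC0
  have h8 : ε ^ p / (4 * (M + 1)) * (‖z n‖ ^ p + ‖z N‖ ^ p) ≤ ε ^ p / 2 :=
    calc _ ≤ ε ^ p / (4 * (M + 1)) * (2 * (M + 1)) :=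
          mul_le_mul_of_nonneg_left (by linarith) (by positivity)
      _ = ε ^ p / 2 := by field_simp; norm_num
  have h9 : ‖z n - z N‖ ^ p < ε ^ p := by linarith
  exact (Real.rpow_lt_rpow_iff (norm_nonneg _) hε.le hp0).1 h9

end Pointwise

/-! ### Mollification in `L^q`, and decay at infinity of mollified `L²` functions. -/

section Mollification

variable {d : ℕ} {F : Type*} [NormedAddCommGroup F]

/-- Translation is the action of `DomAddAct` on `Lp`, which is continuous for finite exponents. -/
theorem tendsto_eLpNorm_translate_sub {q : ℝ≥0∞} (hq1 : 1 ≤ q) (hq : q ≠ ⊤) {g : Rd d → F}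
    (hg : MemLp g q volume) :
    Tendsto (fun y => eLpNorm (fun x => g (x - y) - g x) q volume) (𝓝 (0 : Rd d)) (𝓝 0) := by
  have : Fact (1 ≤ q) := ⟨hq1⟩
  have : Fact (q ≠ ⊤) := ⟨hq⟩
  have hc : Continuous fun y : Rd d => DomAddAct.mk (-y) +ᵥ hg.toLp g :=
    (DomAddAct.continuous_mk.comp continuous_neg).vadd continuous_const
  have h0 : Tendsto (fun y : Rd d => edist (DomAddAct.mk (-y) +ᵥ hg.toLp g) (hg.toLp g)) (𝓝 0)
      (𝓝 0) := by
    have h1 := (hc.tendsto 0).edist (tendsto_const_nhds (x := hg.toLp g))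
    have h2 : DomAddAct.mk (-(0 : Rd d)) +ᵥ hg.toLp g = hg.toLp g := by
      rw [DomAddAct.mk_vadd_toLp]; simp
    rwa [h2, edist_self] at h1
  refine h0.congr fun y => ?_
  rw [DomAddAct.mk_vadd_toLp, Lp.edist_toLp_toLp]
  refine eLpNorm_congr_ae (.of_forall fun x => ?_)
  simp only [Pi.sub_apply, vadd_eq_add]
  rw [neg_add_eq_sub]

variable [NormedSpace ℝ F]

theorem continuous_convolution_normed (ρ : ContDiffBump (0 : Rd d)) {g : Rd d → F}
    (hg : LocallyIntegrable g volume) :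
    Continuous (ρ.normed volume ⋆[ContinuousLinearMap.lsmul ℝ ℝ] g) :=
  ρ.hasCompactSupport_normed.continuous_convolution_left _ ρ.continuous_normed hg

variable [CompleteSpace F]

/-- By Jensen's inequality, mollification moves a function by at most as much as translations do. -/
theorem eLpNorm_convolution_sub_le (ρ : ContDiffBump (0 : Rd d)) {q : ℝ≥0∞} (hq1 : 1 ≤ q)
    (hq : q ≠ ⊤) {g : Rd d → F} (hg : MemLp g q volume) {ε : ℝ≥0∞}
    (h : ∀ y ∈ Metric.ball (0 : Rd d) ρ.rOut, eLpNorm (fun x => g (x - y) - g x) q volume ≤ ε) :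
    eLpNorm (fun x => (ρ.normed volume ⋆[ContinuousLinearMap.lsmul ℝ ℝ] g) x - g x) q volume
      ≤ ε := by
  set k : Rd d → ℝ := ρ.normed volume with hk
  have hkc : Continuous k := ρ.continuous_normed
  have hkm : Measurable fun t => ENNReal.ofReal (k t) := hkc.measurable.ennreal_ofReal
  have hk0 : ∀ t, 0 ≤ k t := ρ.nonneg_normed
  -- The kernel as a probability measure: Jensen becomes monotonicity of `eLpNorm'` in the exponent,
  -- and Tonelli exchanges the integrals.
  set ν : Measure (Rd d) := volume.withDensity fun t => ENNReal.ofReal (k t) with hν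
  have hνac : ν ≪ volume := withDensity_absolutelyContinuous _ _
  have : IsProbabilityMeasure ν := by
    refine ⟨?_⟩
    rw [hν, withDensity_apply _ MeasurableSet.univ, Measure.restrict_univ,
      ← ofReal_integral_eq_lintegral_ofReal ρ.integrable_normed (.of_forall hk0),
      ρ.integral_normed, ENNReal.ofReal_one]
  have hr1 : 1 ≤ q.toReal := by
    rw [← ENNReal.toReal_one]; exact ENNReal.toReal_mono hq hq1
  set r := q.toReal with hr
  have hr0 : 0 < r := by linarith
  have hq0 : q ≠ 0 := (zero_lt_one.trans_le hq1).ne'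
  have hgl : LocallyIntegrable g volume := hg.locallyIntegrable hq1
  have hmeas : ∀ x, AEStronglyMeasurable (fun t => g (x - t) - g x) volume := fun x =>
    (hg.1.comp_quasiMeasurePreserving (quasiMeasurePreserving_sub_left volume x)).sub
      aestronglyMeasurable_const
  have hpt : ∀ x, ‖(k ⋆[ContinuousLinearMap.lsmul ℝ ℝ] g) x - g x‖ₑ ^ r ≤
      ∫⁻ t, ‖g (x - t) - g x‖ₑ ^ r ∂ν := by
    intro x
    have hint : Integrable (fun t => k t • g (x - t)) volume :=
      (ρ.hasCompactSupport_normed.convolutionExists_left (ContinuousLinearMap.lsmul ℝ ℝ)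
        hkc hgl) x
    have h1 : (k ⋆[ContinuousLinearMap.lsmul ℝ ℝ] g) x - g x = ∫ t, k t • (g (x - t) - g x) := by
      simp_rw [smul_sub]
      rw [integral_sub hint (ρ.integrable_normed.smul_const _), ρ.integral_normed_smul]
      rfl
    have h2 : ‖(k ⋆[ContinuousLinearMap.lsmul ℝ ℝ] g) x - g x‖ₑ ≤ ∫⁻ t, ‖g (x - t) - g x‖ₑ ∂ν := by
      rw [h1, hν, lintegral_withDensity_eq_lintegral_mul₀ hkm.aemeasurable (hmeas x).enorm]
      refine (enorm_integral_le_lintegral_enorm _).trans (le_of_eq (lintegral_congr fun t => ?_))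
      rw [enorm_smul, Pi.mul_apply, Real.enorm_of_nonneg (hk0 t)]
    have h3 := eLpNorm'_le_eLpNorm'_of_exponent_le one_pos hr1 ν ((hmeas x).mono_ac hνac)
    simp only [eLpNorm', ENNReal.rpow_one, one_div_one] at h3
    refine (ENNReal.rpow_le_rpow (h2.trans h3) hr0.le).trans (le_of_eq ?_)
    rw [← ENNReal.rpow_mul, one_div_mul_cancel hr0.ne', ENNReal.rpow_one]
  have hprod : AEMeasurable (Function.uncurry fun x t => ‖g (x - t) - g x‖ₑ ^ r)
      ((volume : Measure (Rd d)).prod ν) := by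
    have h1 : AEStronglyMeasurable (fun z : Rd d × Rd d => g (z.1 - z.2) - g z.1)
        ((volume : Measure (Rd d)).prod ν) :=
      (hg.1.comp_quasiMeasurePreserving
        (quasiMeasurePreserving_sub_of_right_invariant volume ν)).sub hg.1.comp_fst
    exact h1.enorm.pow_const r
  have hball : ∀ᵐ t ∂ν, ∫⁻ x, ‖g (x - t) - g x‖ₑ ^ r ≤ ε ^ r := by
    rw [hν, ae_withDensity_iff hkm]
    refine .of_forall fun t ht => ?_
    have htb : t ∈ Metric.ball (0 : Rd d) ρ.rOut := by
      rw [← ρ.support_normed_eq (μ := volume)]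
      intro h0
      exact ht (by rw [hk, h0, ENNReal.ofReal_zero])
    have := h t htb
    rw [eLpNorm_eq_eLpNorm' hq0 hq, eLpNorm', ← hr] at this
    have h4 := ENNReal.rpow_le_rpow this hr0.le
    rwa [← ENNReal.rpow_mul, one_div_mul_cancel hr0.ne', ENNReal.rpow_one] at h4
  rw [eLpNorm_eq_eLpNorm' hq0 hq, eLpNorm', ← hr]
  have hfin : ∫⁻ x, ‖(k ⋆[ContinuousLinearMap.lsmul ℝ ℝ] g) x - g x‖ₑ ^ r ≤ ε ^ r :=
    calc _ ≤ ∫⁻ x, ∫⁻ t, ‖g (x - t) - g x‖ₑ ^ r ∂ν := lintegral_mono hpt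
      _ = ∫⁻ t, ∫⁻ x, ‖g (x - t) - g x‖ₑ ^ r ∂volume ∂ν := lintegral_lintegral_swap hprod
      _ ≤ ∫⁻ _, ε ^ r ∂ν := lintegral_mono_ae hball
      _ = ε ^ r := by rw [lintegral_const, measure_univ, mul_one]
  refine (ENNReal.rpow_le_rpow hfin (by positivity)).trans (le_of_eq ?_)
  rw [← ENNReal.rpow_mul, mul_one_div_cancel hr0.ne', ENNReal.rpow_one]

/-- Translates differ from `g` by at most twice its norm, so the previous bound puts the difference
from `g` in `L^q`; Young's convolution inequality is not used. -/
theorem memLp_convolution_normed (ρ : ContDiffBump (0 : Rd d)) {q : ℝ≥0∞} (hq1 : 1 ≤ q)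
    (hq : q ≠ ⊤) {g : Rd d → F} (hg : MemLp g q volume) :
    MemLp (ρ.normed volume ⋆[ContinuousLinearMap.lsmul ℝ ℝ] g) q volume := by
  have hc := continuous_convolution_normed ρ (hg.locallyIntegrable hq1)
  have hb : ∀ y ∈ Metric.ball (0 : Rd d) ρ.rOut,
      eLpNorm (fun x => g (x - y) - g x) q volume ≤ eLpNorm g q volume + eLpNorm g q volume := by
    intro y _
    have hmp : MeasurePreserving (fun x : Rd d => x - y) volume volume :=
      measurePreserving_sub_right volume y
    have hm : AEStronglyMeasurable (fun x => g (x - y)) volume := hg.1.comp_measurePreserving hmp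
    refine (eLpNorm_sub_le hm hg.1 hq1).trans (le_of_eq ?_)
    congr 1
    exact eLpNorm_comp_measurePreserving hg.1 hmp
  have h1 : MemLp (fun x => (ρ.normed volume ⋆[ContinuousLinearMap.lsmul ℝ ℝ] g) x - g x) q
      volume := ⟨(hc.aestronglyMeasurable).sub hg.1,
    (eLpNorm_convolution_sub_le ρ hq1 hq hg hb).trans_lt (ENNReal.add_lt_top.2 ⟨hg.2, hg.2⟩)⟩
  have h2 := h1.add hg
  refine h2.ae_eq (.of_forall fun x => ?_)
  simp

theorem tendsto_eLpNorm_convolution_sub {ι : Type*} {l : Filter ι} {ρ : ι → ContDiffBump (0 : Rd d)}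
    (hρ : Tendsto (fun i => (ρ i).rOut) l (𝓝 0)) {q : ℝ≥0∞} (hq1 : 1 ≤ q) (hq : q ≠ ⊤)
    {g : Rd d → F} (hg : MemLp g q volume) :
    Tendsto (fun i => eLpNorm (fun x =>
      ((ρ i).normed volume ⋆[ContinuousLinearMap.lsmul ℝ ℝ] g) x - g x) q volume) l (𝓝 0) := by
  rw [ENNReal.tendsto_nhds_zero]
  intro ε hε
  have h1 := (ENNReal.tendsto_nhds_zero.1 (tendsto_eLpNorm_translate_sub hq1 hq hg)) ε hε
  obtain ⟨δ, hδ, hball⟩ := Metric.eventually_nhds_iff_ball.1 h1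
  filter_upwards [hρ.eventually (gt_mem_nhds hδ)] with i hi
  exact eLpNorm_convolution_sub_le _ hq1 hq hg fun y hy =>
    hball y (Metric.ball_subset_ball hi.le hy)

/-- The mollification of an `L²` function tends to zero at infinity. -/
theorem tendsto_convolution_normed_cocompact (ρ : ContDiffBump (0 : Rd d)) {u : Rd d → ℝ}
    (hu : MemLp u 2 volume) :
    Tendsto (ρ.normed volume ⋆[ContinuousLinearMap.lsmul ℝ ℝ] u) (cocompact (Rd d)) (𝓝 0) := by
  set k : Rd d → ℝ := ρ.normed volume with hk
  have hkc : Continuous k := ρ.continuous_normed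
  have hk2 : MemLp k 2 volume := hkc.memLp_of_hasCompactSupport ρ.hasCompactSupport_normed
  have key : ∀ ε : ℝ≥0∞, ε ≠ 0 → ∀ᶠ x in cocompact (Rd d),
      ‖(k ⋆[ContinuousLinearMap.lsmul ℝ ℝ] u) x‖ₑ ≤ eLpNorm k 2 volume * ε := by
    intro ε hε
    -- Off `tsupport h + tsupport k` the convolution sees only `u - h`, which is small in `L²`;
    -- Cauchy–Schwarz concludes.
    obtain ⟨h, hcs, hle, hcont, hh2⟩ := hu.exists_hasCompactSupport_eLpNorm_sub_le (by simp) hε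
    have hK : IsCompact (tsupport h + tsupport k) :=
      IsCompact.add hcs ρ.hasCompactSupport_normed
    filter_upwards [hK.compl_mem_cocompact] with x hx
    have hmp : MeasurePreserving (fun t : Rd d => x - t) volume volume :=
      Measure.measurePreserving_sub_left volume x
    have h1 : (k ⋆[ContinuousLinearMap.lsmul ℝ ℝ] u) x = ∫ t, k t • (u - h) (x - t) := by
      refine integral_congr_ae (.of_forall fun t => ?_)
      change k t • u (x - t) = k t • (u (x - t) - h (x - t))
      by_cases ht : k t = 0
      · rw [ht, zero_smul, zero_smul]
      · have : h (x - t) = 0 := by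
          by_contra h0
          exact hx ⟨x - t, subset_tsupport _ h0, t, subset_tsupport _ ht, by simp⟩
        rw [this, sub_zero]
    rw [h1]
    refine (enorm_integral_le_lintegral_enorm _).trans ?_
    have h2 : AEStronglyMeasurable (fun t => (u - h) (x - t)) volume :=
      (hu.1.sub hh2.1).comp_measurePreserving hmp
    have h3 := eLpNorm_smul_le_mul_eLpNorm (p := 2) (q := 2) (r := 1) h2 hk2.1
    rw [eLpNorm_one_eq_lintegral_enorm] at h3
    refine h3.trans (mul_le_mul_right (le_trans (le_of_eq ?_) hle) _)
    exact eLpNorm_comp_measurePreserving (hu.1.sub hh2.1) hmp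
  rw [EMetric.tendsto_nhds]
  intro ε hε
  have hkfin : eLpNorm k 2 volume ≠ ⊤ := hk2.2.ne
  obtain ⟨δ, hδ0, hδ⟩ : ∃ δ : ℝ≥0∞, δ ≠ 0 ∧ eLpNorm k 2 volume * δ < ε := by
    have ht : Tendsto (fun δ : ℝ≥0∞ => eLpNorm k 2 volume * δ) (𝓝[>] 0) (𝓝 0) := by
      have := ENNReal.Tendsto.const_mul (a := eLpNorm k 2 volume) (tendsto_id (α := ℝ≥0∞) (x := 𝓝 0))
        (Or.inr hkfin)
      rw [mul_zero] at this
      exact this.mono_left nhdsWithin_le_nhds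
    obtain ⟨δ, h1, h2⟩ := ((ht.eventually (gt_mem_nhds hε)).and self_mem_nhdsWithin).exists
    exact ⟨δ, (show 0 < δ from h2).ne', h1⟩
  filter_upwards [key δ hδ0] with x hx
  rw [edist_zero_right]
  exact hx.trans_lt hδ

end Mollification

/-! ### Mollification and the weak gradient. -/

section WeakGradient

variable {d : ℕ}

theorem gradient_comp_const_sub {k : Rd d → ℝ} (hk : Differentiable ℝ k) (x t : Rd d) :
    ∇ (fun t => k (x - t)) t = -∇ k (x - t) := by
  rw [gradient, gradient, ← map_neg]
  congr 1
  refine HasFDerivAt.fderiv ?_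
  refine ((hk (x - t)).hasFDerivAt.comp t ((hasFDerivAt_id t).const_sub x)).congr_fderiv ?_
  ext y
  simp

theorem contDiff_convolution_normed (ρ : ContDiffBump (0 : Rd d)) {u : Rd d → ℝ}
    (hu : LocallyIntegrable u volume) :
    ContDiff ℝ ∞ (ρ.normed volume ⋆[ContinuousLinearMap.lsmul ℝ ℝ] u) :=
  ρ.hasCompactSupport_normed.contDiff_convolution_left _ ρ.contDiff_normed hu

/-- Mollification commutes with the weak gradient. -/
theorem HasWeakGradient.gradient_convolution {u : Rd d → ℝ} {g : Rd d → Rd d}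
    (h : HasWeakGradient u g) (ρ : ContDiffBump (0 : Rd d)) (x : Rd d) :
    ∇ (ρ.normed volume ⋆[ContinuousLinearMap.lsmul ℝ ℝ] u) x =
      (ρ.normed volume ⋆[ContinuousLinearMap.lsmul ℝ ℝ] g) x := by
  set k : Rd d → ℝ := ρ.normed volume with hk
  have hks : HasCompactSupport k := ρ.hasCompactSupport_normed
  have hkd : ContDiff ℝ ∞ k := ρ.contDiff_normed
  have hk1 : ContDiff ℝ 1 k := hkd.of_le (by simp)
  -- The reflected kernel is the test function; the sign from the reflection cancels the one from
  -- integration by parts.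
  have hG := h.2.2 (fun t => k (x - t)) (hkd.comp (contDiff_const.sub contDiff_id))
    (hks.comp_homeomorph (Homeomorph.subLeft x))
  simp_rw [gradient_comp_const_sub (hkd.differentiable (by simp)), smul_neg, integral_neg, neg_inj] at hG
  have h1 : (k ⋆[ContinuousLinearMap.lsmul ℝ ℝ] g) x = ∫ t, k (x - t) • g t :=
    (convolution_eq_swap _).trans rfl
  rw [h1, ← hG]
  refine ext_inner_right ℝ fun y => ?_
  rw [inner_gradient_left, ← convolution_flip,
    (hks.hasFDerivAt_convolution_right (ContinuousLinearMap.lsmul ℝ ℝ).flip h.1 hk1 x).fderiv,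
    convolution_precompR_apply _ h.1 (hks.fderiv ℝ) (hk1.continuous_fderiv one_ne_zero)]
  have hint : Integrable (fun t => u t • ∇ k (x - t)) volume := by
    have hgc : Continuous (∇ k) :=
      (InnerProductSpace.toDual ℝ (Rd d)).symm.continuous.comp (hk1.continuous_fderiv one_ne_zero)
    refine h.1.integrable_smul_right_of_hasCompactSupport
      (hgc.comp (continuous_const.sub continuous_id)) ?_
    have : HasCompactSupport (∇ k) := (hks.fderiv ℝ).comp_left (map_zero _)
    exact this.comp_homeomorph (Homeomorph.subLeft x)
  rw [real_inner_comm, ← integral_inner hint]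
  refine integral_congr_ae (.of_forall fun t => ?_)
  simp only [real_inner_smul_right]
  rw [real_inner_comm, inner_gradient_left]
  simp [mul_comm]

end WeakGradient

/-! ### Hölder pairing of vector fields and its continuity. -/

section Pairing

variable {α E : Type*} [MeasurableSpace α] {μ : Measure α} [NormedAddCommGroup E]
  [InnerProductSpace ℝ E]

theorem memLp_one_inner {p q : ℝ≥0∞} [p.HolderConjugate q] {F h : α → E} (hF : MemLp F p μ)
    (hh : MemLp h q μ) : MemLp (fun x => inner ℝ (F x) (h x)) 1 μ :=
  hF.of_bilin (fun a b => inner ℝ a b) 1 hh (hF.1.inner hh.1)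
    (.of_forall fun x => by rw [one_mul]; exact nnnorm_inner_le_nnnorm _ _)

theorem integrable_inner_of_holderConjugate {p q : ℝ≥0∞} [p.HolderConjugate q] {F h : α → E}
    (hF : MemLp F p μ) (hh : MemLp h q μ) : Integrable (fun x => inner ℝ (F x) (h x)) μ :=
  memLp_one_iff_integrable.1 (memLp_one_inner hF hh)

theorem tendsto_integral_inner {ι : Type*} {l : Filter ι} {p q : ℝ≥0∞} [p.HolderConjugate q]
    {F h : α → E} {H : ι → α → E} (hF : MemLp F p μ) (hh : MemLp h q μ) (hH : ∀ i, MemLp (H i) q μ)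
    (hlim : Tendsto (fun i => eLpNorm (fun x => H i x - h x) q μ) l (𝓝 0)) :
    Tendsto (fun i => ∫ x, inner ℝ (F x) (H i x) ∂μ) l (𝓝 (∫ x, inner ℝ (F x) (h x) ∂μ)) := by
  refine tendsto_integral_of_L1' _ (memLp_one_inner hF hh).1
    (.of_forall fun i => integrable_inner_of_holderConjugate hF (hH i)) ?_
  have h1 : Tendsto (fun i => eLpNorm F p μ * eLpNorm (fun x => H i x - h x) q μ) l (𝓝 0) := by
    have := ENNReal.Tendsto.const_mul hlim (Or.inr hF.2.ne)
    rwa [mul_zero] at this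
  refine tendsto_of_tendsto_of_tendsto_of_le_of_le tendsto_const_nhds h1 (fun _ => zero_le)
    fun i => ?_
  have h2 := eLpNorm_le_eLpNorm_mul_eLpNorm_of_nnnorm (r := 1) (p := p) (q := q) hF.1
    ((hH i).1.sub hh.1) (fun a b => inner ℝ a b) 1
    (.of_forall fun x => by rw [one_mul]; exact nnnorm_inner_le_nnnorm _ _)
  rw [ENNReal.coe_one, one_mul] at h2
  refine le_trans (le_of_eq (eLpNorm_congr_ae (.of_forall fun x => ?_))) h2
  simp [inner_sub_right]

end Pairing

/-! ### Smooth truncation of values. -/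

section Truncation

/-- Smooth truncations of the identity that vanish near zero. -/
theorem exists_contDiff_truncation : ∃ (θ : ℕ → ℝ → ℝ) (C : ℝ), (∀ n, ContDiff ℝ ∞ (θ n)) ∧
    (∀ n, ∃ δ > 0, ∀ s, |s| ≤ δ → θ n s = 0) ∧ (∀ n s, |θ n s| ≤ |s|) ∧
    (∀ n s, |deriv (θ n) s| ≤ C) ∧ (∀ s, Tendsto (fun n => θ n s) atTop (𝓝 s)) ∧
    ∀ s, Tendsto (fun n => deriv (θ n) s) atTop (𝓝 (if s = 0 then 0 else 1)) := by
  let χ : ContDiffBump (0 : ℝ) := ⟨1, 2, one_pos, one_lt_two⟩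
  have hχ : ContDiff ℝ ∞ χ := χ.contDiff
  -- `η` is the identity on `[-1, 1]` and vanishes beyond `2`. The truncations are `s - η(N s) / N`:
  -- the scaling leaves the bound on the derivative independent of `N`.
  set η : ℝ → ℝ := fun t => t * χ t with hη
  have hηd : ContDiff ℝ ∞ η := contDiff_id.mul hχ
  have hηs : HasCompactSupport η := χ.hasCompactSupport.mul_left
  have hηdiff : Differentiable ℝ η := hηd.differentiable (by simp)
  have hη1 : ∀ t, |t| ≤ 1 → η t = t := fun t ht => by
    simp only [hη, χ.one_of_mem_closedBall (show t ∈ Metric.closedBall 0 χ.rIn by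
      simpa [Real.norm_eq_abs] using ht), mul_one]
  have hη2 : ∀ t, 2 ≤ |t| → η t = 0 := fun t ht => by
    simp only [hη, χ.zero_of_le_dist (show χ.rOut ≤ dist t 0 by
      simpa [Real.norm_eq_abs] using ht), mul_zero]
  obtain ⟨C, hC⟩ := (hηd.continuous_deriv (by simp)).bounded_above_of_compact_support hηs.deriv
  let N : ℕ → ℝ := fun n => (n : ℝ) + 1
  have hN : ∀ n, 0 < N n := fun n => by positivity
  have hder : ∀ n s, HasDerivAt (fun s => s - (N n)⁻¹ * η (N n * s)) (1 - deriv η (N n * s)) s := by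
    intro n s
    have h1 : HasDerivAt (fun s => η (N n * s)) (deriv η (N n * s) * N n) s :=
      (hηdiff (N n * s)).hasDerivAt.comp s ((hasDerivAt_id s).const_mul (N n) |>.congr_deriv
        (mul_one _))
    refine ((hasDerivAt_id s).sub (h1.const_mul (N n)⁻¹)).congr_deriv ?_
    field_simp [(hN n).ne']
  have hlarge : ∀ s : ℝ, s ≠ 0 → ∀ᶠ n in atTop, 2 < |N n * s| := by
    intro s hs
    have : Tendsto (fun n => |N n * s|) atTop atTop := by
      simp_rw [abs_mul]
      refine Tendsto.atTop_mul_const (abs_pos.2 hs) ?_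
      exact tendsto_abs_atTop_atTop.comp
        (tendsto_atTop_add_const_right _ _ tendsto_natCast_atTop_atTop)
    exact this.eventually_gt_atTop 2
  refine ⟨fun n s => s - (N n)⁻¹ * η (N n * s), 1 + C, fun n => ?_, fun n => ?_, fun n s => ?_,
    fun n s => ?_, fun s => ?_, fun s => ?_⟩
  · exact contDiff_id.sub (contDiff_const.mul (hηd.comp (contDiff_const.mul contDiff_id)))
  · refine ⟨(N n)⁻¹, inv_pos.2 (hN n), fun s hs => ?_⟩
    have : |N n * s| ≤ 1 := by
      rw [abs_mul, abs_of_pos (hN n)]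
      calc N n * |s| ≤ N n * (N n)⁻¹ := mul_le_mul_of_nonneg_left hs (hN n).le
        _ = 1 := mul_inv_cancel₀ (hN n).ne'
    simp only
    rw [hη1 _ this, inv_mul_cancel_left₀ (hN n).ne', sub_self]
  · have h1 : s - (N n)⁻¹ * η (N n * s) = s * (1 - χ (N n * s)) := by
      simp only [hη]
      field_simp [(hN n).ne']
    beta_reduce
    rw [h1, abs_mul]
    refine mul_le_of_le_one_right (abs_nonneg _) ?_
    rw [abs_of_nonneg (sub_nonneg.2 χ.le_one)]
    linarith [χ.nonneg' (N n * s)]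
  · rw [(hder n s).deriv]
    have h1 := hC (N n * s)
    rw [Real.norm_eq_abs] at h1
    calc |1 - deriv η (N n * s)| ≤ |1| + |deriv η (N n * s)| := abs_sub _ _
      _ ≤ 1 + C := by rw [abs_one]; linarith
  · rcases eq_or_ne s 0 with rfl | hs
    · simp [hη]
    · refine tendsto_const_nhds.congr' ?_
      filter_upwards [hlarge s hs] with n hn
      rw [hη2 _ hn.le, mul_zero, sub_zero]
  · simp_rw [fun n => (hder n s).deriv]
    rcases eq_or_ne s 0 with rfl | hs
    · have : deriv η 0 = 1 := by
        have h1 : η =ᶠ[𝓝 0] id := by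
          filter_upwards [Metric.closedBall_mem_nhds (0 : ℝ) one_pos] with t ht
          exact hη1 t (by simpa [Real.norm_eq_abs] using ht)
        rw [h1.deriv_eq]; simp
      simp [this]
    · rw [if_neg hs]
      refine tendsto_const_nhds.congr' ?_
      filter_upwards [hlarge s hs] with n hn
      have h1 : η =ᶠ[𝓝 (N n * s)] fun _ => 0 := by
        filter_upwards [(isOpen_lt continuous_const continuous_abs).mem_nhds hn] with t ht
        exact hη2 t (le_of_lt ht)
      rw [h1.deriv_eq]; simp

end Truncation

/-! ### Integration by parts for fields with weak divergence. -/

section IntegrationByParts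

variable {d : ℕ}

theorem continuous_gradient {v : Rd d → ℝ} (hv : ContDiff ℝ ∞ v) : Continuous (∇ v) :=
  (InnerProductSpace.toDual ℝ (Rd d)).symm.continuous.comp (hv.continuous_fderiv (by simp))

theorem hasCompactSupport_gradient {v : Rd d → ℝ} (hv : HasCompactSupport v) :
    HasCompactSupport (∇ v) :=
  (hv.fderiv ℝ).comp_left (map_zero (InnerProductSpace.toDual ℝ (Rd d)).symm)

theorem gradient_comp {θ : ℝ → ℝ} (hθ : Differentiable ℝ θ) {v : Rd d → ℝ}
    (hv : Differentiable ℝ v) (x : Rd d) : ∇ (θ ∘ v) x = deriv θ (v x) • ∇ v x := by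
  have h := (hθ (v x)).hasDerivAt.comp_hasFDerivAt x (hv x).hasFDerivAt
  rw [gradient, h.fderiv, map_smul]; rfl

theorem hasWeakGradient_of_contDiff {v : Rd d → ℝ} (hv : ContDiff ℝ ∞ v) :
    HasWeakGradient v (∇ v) := by
  have hvl := hv.continuous.locallyIntegrable (μ := volume)
  have hgl := (continuous_gradient hv).locallyIntegrable (μ := volume)
  refine ⟨hvl, hgl, fun φ hφ hφs => ext_inner_right ℝ fun y => ?_⟩
  have hi1 : Integrable (fun x => v x • ∇ φ x) volume :=
    hvl.integrable_smul_right_of_hasCompactSupport (continuous_gradient hφ)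
      (hasCompactSupport_gradient hφs)
  have hi2 : Integrable (fun x => φ x • ∇ v x) volume :=
    hgl.integrable_smul_left_of_hasCompactSupport hφ.continuous hφs
  rw [inner_neg_left, real_inner_comm, ← integral_inner hi1, real_inner_comm, ← integral_inner hi2]
  simp only [real_inner_smul_right, inner_gradient_right, conj_trivial]
  have h1 := integral_mul_fderiv_eq_neg_fderiv_mul_of_integrable (μ := volume) (f := v) (g := φ)
    (v := y) (((hi2.const_inner y)).congr (.of_forall fun x => by
      simp [real_inner_smul_right, inner_gradient_right, mul_comm]))
    (((hi1.const_inner y)).congr (.of_forall fun x => by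
      simp [real_inner_smul_right, inner_gradient_right]))
    ((hvl.integrable_smul_left_of_hasCompactSupport hφ.continuous hφs).congr
      (.of_forall fun x => by simp [mul_comm]))
    (fun x _ => hv.differentiable (by simp) x) (fun x _ => hφ.differentiable (by simp) x)
  rw [h1]
  simp_rw [mul_comm]

/-- The gradient of a smooth function vanishes almost everywhere on its zero set. -/
theorem ae_gradient_eq_zero_of_eq_zero {v : Rd d → ℝ} (hv : ContDiff ℝ ∞ v) :
    ∀ᵐ x, v x = 0 → ∇ v x = 0 := by
  have hvd : Differentiable ℝ v := hv.differentiable (by simp)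
  have hgc := continuous_gradient hv
  have hw := hasWeakGradient_of_contDiff hv
  obtain ⟨θ, C, hθ, -, hθle, hθC, hθlim, hθ'lim⟩ := exists_contDiff_truncation
  have hθd : ∀ n, Differentiable ℝ (θ n) := fun n => (hθ n).differentiable (by simp)
  -- Passing to the limit in `∇(θ n ∘ v) = θ n'(v) ∇v` shows that `∇v` cut to `{v ≠ 0}` is also a
  -- weak gradient of `v`; uniqueness then gives the claim.
  have hw' : HasWeakGradient v (Set.indicator {x | v x ≠ 0} (∇ v)) := by
    refine ⟨hw.1, hw.2.1.indicator (isOpen_ne_fun hv.continuous continuous_const).measurableSet,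
      fun φ hφ hφs => ?_⟩
    have h1 : Tendsto (fun n => ∫ x, (θ n ∘ v) x • ∇ φ x) atTop (𝓝 (∫ x, v x • ∇ φ x)) := by
      refine tendsto_integral_of_dominated_convergence (fun x => ‖v x • ∇ φ x‖) (fun n => ?_) ?_
        (fun n => .of_forall fun x => ?_) (.of_forall fun x => ?_)
      · exact (((hθ n).continuous.comp hv.continuous).smul
          (continuous_gradient hφ)).aestronglyMeasurable
      · exact (hw.1.integrable_smul_right_of_hasCompactSupport (continuous_gradient hφ)
          (hasCompactSupport_gradient hφs)).norm
      · rw [norm_smul, norm_smul]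
        exact mul_le_mul_of_nonneg_right (hθle n (v x)) (norm_nonneg _)
      · exact (hθlim (v x)).smul_const _
    have h2 : Tendsto (fun n => ∫ x, φ x • ∇ (θ n ∘ v) x) atTop
        (𝓝 (∫ x, φ x • Set.indicator {x | v x ≠ 0} (∇ v) x)) := by
      refine tendsto_integral_of_dominated_convergence (fun x => C * ‖φ x • ∇ v x‖) (fun n => ?_) ?_
        (fun n => .of_forall fun x => ?_) (.of_forall fun x => ?_)
      · exact (hφ.continuous.smul
          (continuous_gradient ((hθ n).comp hv))).aestronglyMeasurable
      · exact (hw.2.1.integrable_smul_left_of_hasCompactSupport hφ.continuous hφs).norm.const_mul C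
      · rw [gradient_comp (hθd n) hvd, smul_comm, norm_smul]
        exact mul_le_mul_of_nonneg_right (hθC n (v x)) (norm_nonneg _)
      · refine Tendsto.const_smul ?_ _
        rw [funext fun n => gradient_comp (hθd n) hvd x]
        have he : Set.indicator {x | v x ≠ 0} (∇ v) x = (if v x = 0 then (0 : ℝ) else 1) • ∇ v x := by
          by_cases hx : v x = 0 <;> simp [hx]
        rw [he]
        exact (hθ'lim (v x)).smul_const (∇ v x)
    refine tendsto_nhds_unique h1 (h2.neg.congr fun n => ?_)
    exact ((hasWeakGradient_of_contDiff ((hθ n).comp hv)).2.2 φ hφ hφs).symm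
  filter_upwards [hw.ae_eq hw'] with x hx hx0
  rw [hx]
  simp [hx0]

/-- A smooth function that tends to zero at infinity is an admissible test function for the weak
divergence, under the natural integrability conditions. -/
theorem HasWeakDivergence.integral_inner_gradient {F : Rd d → Rd d} {w : Rd d → ℝ}
    (h : HasWeakDivergence F w) {v : Rd d → ℝ} (hv : ContDiff ℝ ∞ v)
    (hv0 : Tendsto v (cocompact (Rd d)) (𝓝 0)) (hFv : Integrable (fun x => ‖F x‖ * ‖∇ v x‖) volume)
    (hwv : Integrable (fun x => v x * w x) volume) :
    ∫ x, inner ℝ (F x) (∇ v x) = -∫ x, v x * w x := by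
  have hvd : Differentiable ℝ v := hv.differentiable (by simp)
  obtain ⟨θ, C, hθ, hθ0, hθle, hθC, hθlim, hθ'lim⟩ := exists_contDiff_truncation
  have hθd : ∀ n, Differentiable ℝ (θ n) := fun n => (hθ n).differentiable (by simp)
  have h1 : Tendsto (fun n => ∫ x, (θ n ∘ v) x • w x) atTop (𝓝 (∫ x, v x * w x)) := by
    refine tendsto_integral_of_dominated_convergence (fun x => ‖v x * w x‖) (fun n => ?_) hwv.norm
      (fun n => .of_forall fun x => ?_) (.of_forall fun x => ?_)
    · exact ((hθ n).continuous.comp hv.continuous).aestronglyMeasurable.smul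
        h.2.1.aestronglyMeasurable
    · rw [norm_smul, norm_mul]
      exact mul_le_mul_of_nonneg_right (hθle n (v x)) (norm_nonneg _)
    · exact (hθlim (v x)).mul_const _
  have h2 : Tendsto (fun n => ∫ x, inner ℝ (F x) (∇ (θ n ∘ v) x)) atTop
      (𝓝 (∫ x, inner ℝ (F x) (∇ v x))) := by
    refine tendsto_integral_of_dominated_convergence (fun x => C * (‖F x‖ * ‖∇ v x‖)) (fun n => ?_)
      (hFv.const_mul C) (fun n => .of_forall fun x => ?_) ?_
    · exact h.1.aestronglyMeasurable.inner
        (continuous_gradient ((hθ n).comp hv)).aestronglyMeasurable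
    · rw [gradient_comp (hθd n) hvd, real_inner_smul_right, norm_mul]
      exact mul_le_mul (hθC n (v x)) (norm_inner_le_norm _ _) (norm_nonneg _)
        ((abs_nonneg _).trans (hθC n (v x)))
    -- On `{v = 0}` the derivatives `θ n'` tend to `0`, not `1`; there `∇v` vanishes almost
    -- everywhere.
    · filter_upwards [ae_gradient_eq_zero_of_eq_zero hv] with x hx
      simp_rw [fun n => gradient_comp (hθd n) hvd x,
        real_inner_smul_right]
      have := (hθ'lim (v x)).mul_const (inner ℝ (F x) (∇ v x))
      convert this using 2
      by_cases hx0 : v x = 0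
      · simp [hx hx0]
      · simp [hx0]
  refine tendsto_nhds_unique h2 (h1.neg.congr fun n => ?_)
  refine (h.2.2 (θ n ∘ v) ((hθ n).comp hv) ?_).symm
  -- Outside a compact set `|v| ≤ δ`, where `θ n` vanishes; hence `θ n ∘ v` has compact support.
  obtain ⟨δ, hδ, hz⟩ := hθ0 n
  obtain ⟨K, hK, hKv⟩ := mem_cocompact.1 (hv0 (Metric.closedBall_mem_nhds (0 : ℝ) hδ))
  refine HasCompactSupport.intro hK fun x hx => hz _ ?_
  simpa [Real.norm_eq_abs] using hKv hx

/-- Integration by parts for a weakly differentiable function and a field with weak divergence. -/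
theorem HasWeakDivergence.integral_inner_weakGradient {p q : ℝ≥0∞} [q.HolderConjugate p]
    (hp1 : 1 ≤ p) (hp : p ≠ ⊤) {F g : Rd d → Rd d} {u w : Rd d → ℝ} (h : HasWeakDivergence F w)
    (hF : MemLp F q volume) (hw : MemLp w 2 volume) (hu : MemLp u 2 volume)
    (hug : HasWeakGradient u g) (hg : MemLp g p volume) :
    ∫ x, inner ℝ (F x) (g x) = -∫ x, inner ℝ (w x) (u x) := by
  let ρ : ℕ → ContDiffBump (0 : Rd d) := fun n =>
    ⟨1 / ((n : ℝ) + 1) / 2, 1 / ((n : ℝ) + 1), by positivity, half_lt_self (by positivity)⟩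
  have hρ : Tendsto (fun n => (ρ n).rOut) atTop (𝓝 0) := tendsto_one_div_add_atTop_nhds_zero_nat
  have hmg := fun n => memLp_convolution_normed (ρ n) hp1 hp hg
  have hmu := fun n => memLp_convolution_normed (ρ n) one_le_two ENNReal.ofNat_ne_top hu
  have h1 := tendsto_integral_inner hF hg hmg (tendsto_eLpNorm_convolution_sub hρ hp1 hp hg)
  have h2 := tendsto_integral_inner (p := 2) (q := 2) hw hu hmu
    (tendsto_eLpNorm_convolution_sub hρ one_le_two ENNReal.ofNat_ne_top hu)
  refine tendsto_nhds_unique h1 (h2.neg.congr fun n => ?_)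
  have hgr : ∇ ((ρ n).normed volume ⋆[ContinuousLinearMap.lsmul ℝ ℝ] u) =
      (ρ n).normed volume ⋆[ContinuousLinearMap.lsmul ℝ ℝ] g :=
    funext fun x => hug.gradient_convolution (ρ n) x
  have h3 := h.integral_inner_gradient (contDiff_convolution_normed (ρ n) hug.1)
    (tendsto_convolution_normed_cocompact (ρ n) hu) ?_ ?_
  · rw [hgr] at h3
    exact h3.symm
  · rw [hgr]
    exact hF.norm.integrable_mul (hmg n).norm
  · exact (hmu n).integrable_mul hw

end IntegrationByParts

/-! ### The energy `‖G‖ ^ p` on `L^p` fields: uniform convexity, subgradient inequality, directional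
limits. -/

section LpPower

variable {d : ℕ} {p : ℝ}

/-- The space `L^p(ℝ^d; ℝ^d)` of vector fields. -/
abbrev LpField (d : ℕ) (p : ℝ) : Type := Lp (Rd d) (ENNReal.ofReal p) (volume : Measure (Rd d))

theorem integrable_norm_rpow_of_memLp {E : Type*} [NormedAddCommGroup E] (hp : 1 < p)
    {f : Rd d → E} (hf : MemLp f (ENNReal.ofReal p) volume) :
    Integrable (fun x => ‖f x‖ ^ p) volume := by
  have h := hf.integrable_norm_rpow (by simp; linarith) ENNReal.ofReal_ne_top
  rwa [ENNReal.toReal_ofReal (by linarith)] at h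

theorem integrable_norm_rpow (hp : 1 < p) (G : LpField d p) :
    Integrable (fun x => ‖G x‖ ^ p) volume :=
  integrable_norm_rpow_of_memLp hp (Lp.memLp G)

theorem norm_rpow_eq_integral (hp : 1 < p) (G : LpField d p) :
    ‖G‖ ^ p = ∫ x, ‖G x‖ ^ p := by
  have hp0 : 0 < p := by linarith
  rw [Lp.norm_def, (Lp.memLp G).eLpNorm_eq_integral_rpow_norm (by simp; linarith)
    ENNReal.ofReal_ne_top, ENNReal.toReal_ofReal (by linarith : 0 ≤ p)]
  have h0 : 0 ≤ ∫ x, ‖G x‖ ^ p := integral_nonneg fun x => Real.rpow_nonneg (norm_nonneg _) _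
  rw [ENNReal.toReal_ofReal (Real.rpow_nonneg h0 _), ← Real.rpow_mul h0, inv_mul_cancel₀ hp0.ne',
    Real.rpow_one]

theorem coeFn_smul_add_smul (a b : ℝ) (G K : LpField d p) :
    ⇑(a • G + b • K) =ᵐ[volume] fun x => a • G x + b • K x := by
  filter_upwards [Lp.coeFn_add (a • G) (b • K), Lp.coeFn_smul a G, Lp.coeFn_smul b K]
    with x h1 h2 h3
  rw [h1, Pi.add_apply, h2, h3, Pi.smul_apply, Pi.smul_apply]

/-- The constant of the pointwise inequality does not depend on the vectors, so the inequality can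
be integrated. -/
theorem exists_norm_sub_rpow_le_of_lp (hp : 1 < p) {ε : ℝ} (hε : 0 < ε) :
    ∃ C : ℝ, 0 ≤ C ∧ ∀ G K : LpField d p, ‖G - K‖ ^ p ≤ ε * (‖G‖ ^ p + ‖K‖ ^ p) +
      C * ((‖G‖ ^ p + ‖K‖ ^ p) / 2 - ‖(1 / 2 : ℝ) • G + (1 / 2 : ℝ) • K‖ ^ p) := by
  obtain ⟨C, hC0, hC⟩ := exists_norm_sub_rpow_le (E := Rd d) hp hε
  refine ⟨C, hC0, fun G K => ?_⟩
  simp only [norm_rpow_eq_integral hp]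
  have hG := integrable_norm_rpow hp G
  have hK := integrable_norm_rpow hp K
  have hM := integrable_norm_rpow hp ((1 / 2 : ℝ) • G + (1 / 2 : ℝ) • K)
  have hi1 : Integrable (fun x => ε * (‖G x‖ ^ p + ‖K x‖ ^ p)) volume := (hG.add hK).const_mul ε
  have hi2 : Integrable (fun x => (‖G x‖ ^ p + ‖K x‖ ^ p) / 2) volume := (hG.add hK).div_const 2
  have hi3 : Integrable (fun x => C * ((‖G x‖ ^ p + ‖K x‖ ^ p) / 2 -
    ‖((1 / 2 : ℝ) • G + (1 / 2 : ℝ) • K : LpField d p) x‖ ^ p)) volume := (hi2.sub hM).const_mul C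
  rw [← integral_add hG hK, ← integral_const_mul, ← integral_div, ← integral_sub hi2 hM,
    ← integral_const_mul, ← integral_add hi1 hi3]
  refine integral_mono_ae (integrable_norm_rpow hp (G - K)) (hi1.add hi3) ?_
  filter_upwards [coeFn_smul_add_smul (1 / 2) (1 / 2) G K, Lp.coeFn_sub G K] with x h1 h2
  rw [h1, h2]
  exact hC (G x) (K x)

theorem memLp_norm_rpow_sub_two_smul (hp : 1 < p) (G : LpField d p) :
    MemLp (fun x => ‖G x‖ ^ (p - 2) • G x) (ENNReal.ofReal (p / (p - 1))) volume := by
  have h1 := (Lp.memLp G).norm_rpow_div (ENNReal.ofReal (p - 1))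
  rw [ENNReal.toReal_ofReal (by linarith), ← ENNReal.ofReal_div_of_pos (by linarith)] at h1
  refine h1.congr_norm ((continuous_norm_rpow_sub_two_smul hp).comp_aestronglyMeasurable
    (Lp.aestronglyMeasurable G)) (.of_forall fun x => ?_)
  rw [norm_rpow_sub_two_smul hp, Real.norm_of_nonneg (Real.rpow_nonneg (norm_nonneg _) _)]

theorem holderConjugate_ofReal (hp : 1 < p) :
    (ENNReal.ofReal (p / (p - 1))).HolderConjugate (ENNReal.ofReal p) :=
  (Real.HolderConjugate.conjExponent hp).symm.ennrealOfReal

theorem integrable_inner_norm_rpow_sub_two_smul (hp : 1 < p) (G : LpField d p) {h : Rd d → Rd d}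
    (hh : MemLp h (ENNReal.ofReal p) volume) :
    Integrable (fun x => inner ℝ (‖G x‖ ^ (p - 2) • G x) (h x)) volume :=
  have := holderConjugate_ofReal hp
  integrable_inner_of_holderConjugate (memLp_norm_rpow_sub_two_smul hp G) hh

theorem norm_rpow_add_mul_integral_inner_le (hp : 1 < p) (G K : LpField d p) :
    ‖G‖ ^ p + p * ∫ x, inner ℝ (‖G x‖ ^ (p - 2) • G x) ((K - G) x) ≤ ‖K‖ ^ p := by
  rw [norm_rpow_eq_integral hp, norm_rpow_eq_integral hp, ← integral_const_mul,
    ← integral_add (integrable_norm_rpow hp G)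
      ((integrable_inner_norm_rpow_sub_two_smul hp G (Lp.memLp (K - G))).const_mul p)]
  refine integral_mono_ae ((integrable_norm_rpow hp G).add
      ((integrable_inner_norm_rpow_sub_two_smul hp G (Lp.memLp (K - G))).const_mul p))
    (integrable_norm_rpow hp K) ?_
  filter_upwards [Lp.coeFn_sub K G] with x hx
  rw [hx]
  exact norm_rpow_add_mul_inner_le hp (G x) (K x)

/-- Dominated convergence with majorant `(‖G x‖ + ‖K x‖) ^ p`, which is where `|t n| ≤ 1` enters. -/
theorem tendsto_integral_inner_norm_rpow_sub_two_smul (hp : 1 < p) (G K : LpField d p) {t : ℕ → ℝ}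
    (ht : Tendsto t atTop (𝓝 0)) (ht1 : ∀ n, |t n| ≤ 1) :
    Tendsto (fun n => ∫ x, inner ℝ (‖(G + t n • K) x‖ ^ (p - 2) • (G + t n • K) x) (K x)) atTop
      (𝓝 (∫ x, inner ℝ (‖G x‖ ^ (p - 2) • G x) (K x))) := by
  have hco : ∀ n, ⇑(G + t n • K) =ᵐ[volume] fun x => G x + t n • K x := fun n => by
    filter_upwards [Lp.coeFn_add G (t n • K), Lp.coeFn_smul (t n) K] with x h1 h2
    rw [h1, Pi.add_apply, h2, Pi.smul_apply]
  have hb : Integrable (fun x => ‖‖G x‖ + ‖K x‖‖ ^ p) volume :=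
    integrable_norm_rpow_of_memLp hp ((Lp.memLp G).norm.add (Lp.memLp K).norm)
  refine tendsto_integral_of_dominated_convergence _ (fun n => ?_) hb (fun n => ?_) ?_
  · exact (integrable_inner_norm_rpow_sub_two_smul hp _ (Lp.memLp K)).1
  · filter_upwards [hco n] with x hx
    rw [hx]
    have h1 : ‖G x + t n • K x‖ ≤ ‖G x‖ + ‖K x‖ := by
      refine (norm_add_le _ _).trans (add_le_add_right ?_ _)
      rw [norm_smul]
      exact mul_le_of_le_one_left (norm_nonneg _) (ht1 n)
    have h0 : 0 ≤ ‖G x‖ + ‖K x‖ := by positivity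
    calc _ ≤ ‖‖G x + t n • K x‖ ^ (p - 2) • (G x + t n • K x)‖ * ‖K x‖ := norm_inner_le_norm _ _
      _ = ‖G x + t n • K x‖ ^ (p - 1) * ‖K x‖ := by rw [norm_rpow_sub_two_smul hp]
      _ ≤ (‖G x‖ + ‖K x‖) ^ (p - 1) * (‖G x‖ + ‖K x‖) := by
        refine mul_le_mul (Real.rpow_le_rpow (norm_nonneg _) h1 (by linarith))
          (le_add_of_nonneg_left (norm_nonneg _)) (norm_nonneg _) (by positivity)
      _ = ‖‖G x‖ + ‖K x‖‖ ^ p := by rw [rpow_sub_one_mul_self hp h0, Real.norm_of_nonneg h0]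
  · filter_upwards [ae_all_iff.2 hco] with x hx
    simp_rw [hx]
    have h1 : Tendsto (fun n => G x + t n • K x) atTop (𝓝 (G x)) := by
      simpa using (ht.smul_const (K x)).const_add (G x)
    exact (((continuous_norm_rpow_sub_two_smul hp).tendsto (G x)).comp h1).inner
      tendsto_const_nhds

end LpPower

/-! ### Linearity, closedness and representatives of weak gradients. -/

section WeakGradientLp

variable {d : ℕ} {p : ℝ}

theorem HasWeakGradient.congr {u v : Rd d → ℝ} {g h : Rd d → Rd d} (hu : HasWeakGradient u g)
    (huv : u =ᵐ[volume] v) (hgh : g =ᵐ[volume] h) : HasWeakGradient v h := by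
  refine ⟨hu.1.congr huv, hu.2.1.congr hgh, fun φ hφ hφs => ?_⟩
  rw [integral_congr_ae (g := fun x => u x • ∇ φ x) (huv.mono fun x hx => by simp only [hx]), hu.2.2 φ hφ hφs,
    integral_congr_ae (g := fun x => φ x • h x) (hgh.mono fun x hx => by simp only [hx])]

theorem HasWeakDivergence.congr {F G : Rd d → Rd d} {w z : Rd d → ℝ} (h : HasWeakDivergence F w)
    (hFG : F =ᵐ[volume] G) (hwz : w =ᵐ[volume] z) : HasWeakDivergence G z := by
  refine ⟨h.1.congr hFG, h.2.1.congr hwz, fun φ hφ hφs => ?_⟩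
  rw [integral_congr_ae (g := fun x => inner ℝ (F x) (∇ φ x)) (hFG.mono fun x hx => by simp only [hx]), h.2.2 φ hφ hφs,
    integral_congr_ae (g := fun x => φ x • z x) (hwz.mono fun x hx => by simp only [hx])]

theorem HasWeakGradient.linear_combination {u v : Rd d → ℝ} {g h : Rd d → Rd d} (a b : ℝ)
    (hu : HasWeakGradient u g) (hv : HasWeakGradient v h) :
    HasWeakGradient (fun x => a • u x + b • v x) (fun x => a • g x + b • h x) := by
  refine ⟨(hu.1.smul a).add (hv.1.smul b), (hu.2.1.smul a).add (hv.2.1.smul b),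
    fun φ hφ hφs => ?_⟩
  have hi : ∀ {f : Rd d → ℝ}, LocallyIntegrable f volume → Integrable (fun x => f x • ∇ φ x) volume :=
    fun hf => hf.integrable_smul_right_of_hasCompactSupport (continuous_gradient hφ)
      (hasCompactSupport_gradient hφs)
  have hj : ∀ {f : Rd d → Rd d}, LocallyIntegrable f volume →
      Integrable (fun x => φ x • f x) volume :=
    fun hf => hf.integrable_smul_left_of_hasCompactSupport hφ.continuous hφs
  simp_rw [add_smul, smul_add, smul_assoc, smul_comm _ a, smul_comm _ b]
  rw [integral_add ((hi hu.1).fun_smul a) ((hi hv.1).fun_smul b), integral_add ((hj hu.2.1).fun_smul a)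
    ((hj hv.2.1).fun_smul b), integral_smul, integral_smul, integral_smul, integral_smul,
    hu.2.2 φ hφ hφs, hv.2.2 φ hφ hφs]
  module

theorem HasWeakGradient.lp_linear_combination {u v : L2 d} {G K : LpField d p} (a b : ℝ)
    (hu : HasWeakGradient u G) (hv : HasWeakGradient v K) :
    HasWeakGradient ⇑(a • u + b • v) ⇑(a • G + b • K) := by
  refine (hu.linear_combination a b hv).congr ?_ (coeFn_smul_add_smul a b G K).symm
  filter_upwards [Lp.coeFn_add (a • u) (b • v), Lp.coeFn_smul a u, Lp.coeFn_smul b v]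
    with x h1 h2 h3
  rw [h1, Pi.add_apply, h2, h3, Pi.smul_apply, Pi.smul_apply]

/-- The weak gradient, as an operator from `L²` to `L^p`, is closed. -/
theorem HasWeakGradient.of_tendsto [Fact (1 ≤ ENNReal.ofReal p)] (hp : 1 < p) {u : ℕ → L2 d}
    {v : L2 d} {G : ℕ → LpField d p} {K : LpField d p} (h : ∀ n, HasWeakGradient (u n) (G n))
    (hu : Tendsto u atTop (𝓝 v)) (hG : Tendsto G atTop (𝓝 K)) : HasWeakGradient v K := by
  have := holderConjugate_ofReal hp
  have hvl : LocallyIntegrable v volume := (Lp.memLp v).locallyIntegrable one_le_two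
  have hKl : LocallyIntegrable K volume := (Lp.memLp K).locallyIntegrable Fact.out
  -- Pairing with a fixed vector `y` turns both sides into scalar pairings with fixed functions in
  -- `L²` and `L^{p'}`, which pass to the limit.
  refine ⟨hvl, hKl, fun φ hφ hφs => ext_inner_left ℝ fun y => ?_⟩
  have hi : ∀ {f : Rd d → ℝ}, LocallyIntegrable f volume → Integrable (fun x => f x • ∇ φ x) volume :=
    fun hf => hf.integrable_smul_right_of_hasCompactSupport (continuous_gradient hφ)
      (hasCompactSupport_gradient hφs)
  have hj : ∀ {f : Rd d → Rd d}, LocallyIntegrable f volume →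
      Integrable (fun x => φ x • f x) volume :=
    fun hf => hf.integrable_smul_left_of_hasCompactSupport hφ.continuous hφs
  have hs1 : ∀ {f : Rd d → ℝ}, LocallyIntegrable f volume →
      ∫ x, inner ℝ (inner ℝ y (∇ φ x)) (f x) = inner ℝ y (∫ x, f x • ∇ φ x) := fun hf => by
    rw [← integral_inner (hi hf)]
    simp [real_inner_smul_right]
  have hs2 : ∀ {f : Rd d → Rd d}, LocallyIntegrable f volume →
      ∫ x, inner ℝ (φ x • y) (f x) = inner ℝ y (∫ x, φ x • f x) := fun hf => by
    rw [← integral_inner (hj hf)]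
    simp [real_inner_smul_right, real_inner_smul_left]
  have hm1 : MemLp (fun x => inner ℝ y (∇ φ x)) 2 volume :=
    (continuous_const.inner (continuous_gradient hφ)).memLp_of_hasCompactSupport
      ((hasCompactSupport_gradient hφs).comp_left (inner_zero_right y))
  have hm2 : MemLp (fun x => φ x • y) (ENNReal.ofReal (p / (p - 1))) volume :=
    (hφ.continuous.smul continuous_const).memLp_of_hasCompactSupport hφs.smul_right
  have ht1 := tendsto_integral_inner (p := 2) (q := 2) hm1 (Lp.memLp v) (fun n => Lp.memLp (u n))
    ((Lp.tendsto_Lp_iff_tendsto_eLpNorm' u v).1 hu)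
  have ht2 := tendsto_integral_inner hm2 (Lp.memLp K) (fun n => Lp.memLp (G n))
    ((Lp.tendsto_Lp_iff_tendsto_eLpNorm' G K).1 hG)
  rw [inner_neg_right, ← hs1 hvl, ← hs2 hKl]
  refine tendsto_nhds_unique ht1 (ht2.neg.congr fun n => ?_)
  rw [hs1 (h n).1, hs2 (h n).2.1, (h n).2.2 φ hφ hφs, inner_neg_right]

theorem HasWeakGradient.weakGrad_ae_eq {u : Rd d → ℝ} {g : Rd d → Rd d} (h : HasWeakGradient u g) :
    HasWeakGradient u (weakGrad u) ∧ weakGrad u =ᵐ[volume] g := by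
  have hex : ∃ g, HasWeakGradient u g := ⟨g, h⟩
  have h1 : HasWeakGradient u (weakGrad u) := by
    rw [weakGrad, dif_pos hex]; exact hex.choose_spec
  exact ⟨h1, h1.ae_eq h⟩

theorem HasWeakGradient.gradMemLp {u : Rd d → ℝ} {G : LpField d p} (h : HasWeakGradient u G) :
    GradMemLp p u :=
  ⟨h.weakGrad_ae_eq.1, (Lp.memLp G).ae_eq h.weakGrad_ae_eq.2.symm⟩

theorem GradMemLp.exists_lp {u : Rd d → ℝ} (h : GradMemLp p u) :
    ∃ G : LpField d p, HasWeakGradient u G :=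
  ⟨h.2.toLp _, h.1.congr EventuallyEq.rfl h.2.coeFn_toLp.symm⟩

end WeakGradientLp

/-! ### Values and convexity of the potential. -/

section Potential

variable {d : ℕ} {p : ℝ}

theorem potential_eq (hp : 1 < p) {u : L2 d} {G : LpField d p} (h : HasWeakGradient u G) :
    potential d p u = ((1 / p * ‖G‖ ^ p : ℝ) : EReal) := by
  rw [potential, if_pos h.gradMemLp, norm_rpow_eq_integral hp]
  congr 2
  exact integral_congr_ae (h.weakGrad_ae_eq.2.mono fun x hx => by simp only [hx])

theorem exists_lp_of_potential_ne_top {u : L2 d} (h : potential d p u ≠ ⊤) :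
    ∃ G : LpField d p, HasWeakGradient u G := by
  by_cases hu : GradMemLp p u
  · exact hu.exists_lp
  · exact absurd (if_neg hu) h

theorem potential_nonneg [Fact (1 ≤ ENNReal.ofReal p)] (hp : 1 < p) (u : L2 d) : 0 ≤ potential d p u := by
  by_cases h : potential d p u = ⊤
  · rw [h]; exact le_top
  · obtain ⟨G, hG⟩ := exists_lp_of_potential_ne_top h
    rw [potential_eq hp hG]
    have : 0 < p := by linarith
    exact EReal.coe_nonneg.2 (show 0 ≤ 1 / p * ‖G‖ ^ p by positivity)

theorem hasWeakGradient_zero : HasWeakGradient (⇑(0 : L2 d)) (⇑(0 : LpField d p)) := by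
  have h : HasWeakGradient (fun _ : Rd d => (0 : ℝ)) (fun _ => 0) :=
    ⟨locallyIntegrable_zero, locallyIntegrable_zero, fun φ _ _ => by simp⟩
  exact h.congr (Lp.coeFn_zero ℝ 2 volume).symm
    (Lp.coeFn_zero (Rd d) (ENNReal.ofReal p) volume).symm

theorem potential_zero_ne_top (hp : 1 < p) : potential d p 0 ≠ ⊤ := by
  rw [potential_eq hp hasWeakGradient_zero]
  exact EReal.coe_ne_top _

theorem potential_isConvex [Fact (1 ≤ ENNReal.ofReal p)] (hp : 1 < p) :
    IsConvex (potential d p) := by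
  intro u v a b ha hb hab
  -- In `EReal`, `⊤ + ⊥ = ⊥`, so the infinite cases need the other summand to differ from `⊥`.
  have hbot : ∀ (c : ℝ) (x : L2 d), 0 < c → (c : EReal) * potential d p x ≠ ⊥ := fun c x hc =>
    ne_bot_of_le_ne_bot EReal.zero_ne_bot
      (mul_nonneg (EReal.coe_nonneg.2 hc.le) (potential_nonneg hp x))
  by_cases hu : potential d p u = ⊤
  · rw [hu, EReal.coe_mul_top_of_pos ha, EReal.top_add_of_ne_bot (hbot b v hb)]
    exact le_top
  by_cases hv : potential d p v = ⊤
  · rw [hv, EReal.coe_mul_top_of_pos hb, EReal.add_top_of_ne_bot (hbot a u ha)]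
    exact le_top
  obtain ⟨G, hG⟩ := exists_lp_of_potential_ne_top hu
  obtain ⟨K, hK⟩ := exists_lp_of_potential_ne_top hv
  rw [potential_eq hp (hG.lp_linear_combination a b hK), potential_eq hp hG, potential_eq hp hK,
    ← EReal.coe_mul, ← EReal.coe_mul, ← EReal.coe_add, EReal.coe_le_coe_iff]
  have hp0 : 0 < p := by linarith
  calc 1 / p * ‖a • G + b • K‖ ^ p ≤ 1 / p * (a * ‖G‖ ^ p + b * ‖K‖ ^ p) :=
        mul_le_mul_of_nonneg_left
          (norm_smul_add_smul_rpow_le hp.le G K ha.le hb.le hab) (by positivity)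
    _ = _ := by ring

end Potential

/-! ### Lower semicontinuity of the potential. -/

section Semicontinuity

variable {d : ℕ} {p : ℝ} [Fact (1 ≤ ENNReal.ofReal p)]

theorem potential_le_of_mem_closure (hp : 1 < p) {c : ℝ} {u : L2 d}
    (hu : u ∈ closure {v | potential d p v ≤ (c : EReal)}) : potential d p u ≤ (c : EReal) := by
  have hp0 : 0 < p := by linarith
  let r : ℕ → ℝ := fun n => 1 / ((n : ℝ) + 1)
  have hrlim : Tendsto r atTop (𝓝 0) := tendsto_one_div_add_atTop_nhds_zero_nat
  -- Gradients of energy at most `c` of functions within `r n` of `u`. These sets are nonempty,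
  -- decreasing and midpoint convex, so almost minimisers of the norm form a Cauchy sequence.
  let T : ℕ → Set (LpField d p) := fun n =>
    {G | 1 / p * ‖G‖ ^ p ≤ c ∧ ∃ v : L2 d, HasWeakGradient v G ∧ ‖v - u‖ ≤ r n}
  have hne : ∀ n, (T n).Nonempty := by
    intro n
    obtain ⟨v, hv, hvu⟩ := Metric.mem_closure_iff.1 hu (r n) Nat.one_div_pos_of_nat
    obtain ⟨G, hG⟩ := exists_lp_of_potential_ne_top (ne_top_of_le_ne_top (EReal.coe_ne_top c) hv)
    refine ⟨G, EReal.coe_le_coe_iff.1 ((potential_eq hp hG).symm.trans_le hv), v, hG, ?_⟩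
    rw [dist_comm, dist_eq_norm] at hvu
    exact hvu.le
  have hanti : Antitone T := by
    rintro n m h G ⟨hG, v, hv, hvu⟩
    exact ⟨hG, v, hv, hvu.trans (Nat.one_div_le_one_div h)⟩
  have hmid : ∀ n, ∀ G ∈ T n, ∀ K ∈ T n, (1 / 2 : ℝ) • G + (1 / 2 : ℝ) • K ∈ T n := by
    rintro n G ⟨hG, v, hv, hvu⟩ K ⟨hK, v', hv', hvu'⟩
    refine ⟨?_, _, hv.lp_linear_combination (1 / 2) (1 / 2) hv', ?_⟩
    · refine (mul_le_mul_of_nonneg_left (norm_midpoint_rpow_le hp.le G K)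
        (show 0 ≤ 1 / p by positivity)).trans ?_
      rw [mul_div_assoc', mul_add]
      linarith
    · have h1 : (1 / 2 : ℝ) • v + (1 / 2 : ℝ) • v' - u =
          (1 / 2 : ℝ) • (v - u) + (1 / 2 : ℝ) • (v' - u) := by module
      rw [h1]
      refine (norm_add_le _ _).trans ?_
      rw [norm_smul, norm_smul, Real.norm_of_nonneg (by norm_num)]
      linarith
  have hM : ∀ n, ∀ G ∈ T n, ‖G‖ ^ p ≤ p * c := by
    rintro n G ⟨hG, -⟩
    have h1 := mul_le_mul_of_nonneg_left hG hp0.le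
    rwa [← mul_assoc, mul_one_div_cancel hp0.ne', one_mul] at h1
  obtain ⟨G, hGT, hcau⟩ := exists_cauchySeq_of_midpoint_mem hp0
    (fun ε hε => exists_norm_sub_rpow_le_of_lp hp hε) hne hanti hmid hM
  choose hGc v hvG hvu using hGT
  obtain ⟨K, hK⟩ := cauchySeq_tendsto_of_complete hcau
  have hulim : Tendsto v atTop (𝓝 u) :=
    tendsto_iff_norm_sub_tendsto_zero.2 (squeeze_zero (fun _ => norm_nonneg _) hvu hrlim)
  rw [potential_eq hp (HasWeakGradient.of_tendsto hp hvG hulim hK), EReal.coe_le_coe_iff]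
  exact le_of_tendsto ((hK.norm.rpow_const (Or.inr hp0.le)).const_mul (1 / p)) (.of_forall hGc)

theorem potential_lowerSemicontinuous (hp : 1 < p) : LowerSemicontinuous (potential d p) := by
  refine lowerSemicontinuous_iff_isClosed_preimage.2 fun y => ?_
  induction y with
  | bot =>
    convert isClosed_empty
    refine Set.eq_empty_of_forall_notMem fun u hu => ?_
    exact EReal.zero_ne_bot (le_bot_iff.1 ((potential_nonneg hp u).trans hu))
  | coe c => exact isClosed_of_closure_subset fun u hu => potential_le_of_mem_closure hp hu
  | top => simp

end Semicontinuity

/-! ### Identification of the operator with the subdifferential. -/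

section Subdifferential

variable {d : ℕ} {p : ℝ}

/-- Uniqueness of the weak divergence makes the choice in `pLaplacian` immaterial. -/
theorem mem_pLaplaceOp_iff {u w : L2 d} :
    w ∈ pLaplaceOp d p u ↔ GradMemLp p u ∧ HasWeakDivergence (flux p u) ⇑(-w) := by
  constructor
  · rintro ⟨hu, rfl⟩
    refine ⟨hu.1, ?_⟩
    rw [pLaplacian, neg_neg]
    exact hu.2.choose_spec
  · rintro ⟨hu, hw⟩
    have hD : u ∈ pLaplaceDomain d p := ⟨hu, -w, hw⟩
    refine ⟨hD, ?_⟩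
    rw [pLaplacian, ← neg_eq_iff_eq_neg]
    exact Lp.ext (hw.ae_eq hD.2.choose_spec)

theorem mem_pLaplaceOp_iff_of_hasWeakGradient {u w : L2 d} {G : LpField d p}
    (hG : HasWeakGradient u G) : w ∈ pLaplaceOp d p u ↔
      HasWeakDivergence (fun x => ‖G x‖ ^ (p - 2) • G x) ⇑(-w) := by
  have h : flux p u =ᵐ[volume] fun x => ‖G x‖ ^ (p - 2) • G x :=
    hG.weakGrad_ae_eq.2.mono fun x hx => by simp only [flux, hx]
  rw [mem_pLaplaceOp_iff, and_iff_right hG.gradMemLp]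
  exact ⟨fun hw => hw.congr h EventuallyEq.rfl, fun hw => hw.congr h.symm EventuallyEq.rfl⟩

/-- In the integrated convexity inequality, integration by parts against `v - u` turns the flux term
into `(w, v - u)`. -/
theorem pLaplaceOp_subset_subdifferential [Fact (1 ≤ ENNReal.ofReal p)] (hp : 1 < p) (u : L2 d) :
    pLaplaceOp d p u ⊆ subdifferential (potential d p) u := by
  intro w hw v
  have hp0 : 0 < p := by linarith
  have := holderConjugate_ofReal hp
  obtain ⟨G, hG⟩ := (mem_pLaplaceOp_iff.1 hw).1.exists_lp
  rw [mem_pLaplaceOp_iff_of_hasWeakGradient hG] at hw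
  by_cases hv : potential d p v = ⊤
  · rw [hv, EReal.top_add_coe]; exact le_top
  obtain ⟨K, hK⟩ := exists_lp_of_potential_ne_top hv
  rw [potential_eq hp hG, potential_eq hp hK, ← EReal.coe_add, EReal.coe_le_coe_iff]
  have hKG : HasWeakGradient ⇑(v - u) ⇑(K - G) := by
    have := hK.lp_linear_combination 1 (-1) hG
    rwa [one_smul, one_smul, neg_one_smul, neg_one_smul, ← sub_eq_add_neg, ← sub_eq_add_neg] at this
  have h1 := hw.integral_inner_weakGradient Fact.out ENNReal.ofReal_ne_top
    (memLp_norm_rpow_sub_two_smul hp G) (Lp.memLp (-w)) (Lp.memLp (v - u)) hKG (Lp.memLp (K - G))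
  rw [← L2.inner_def, inner_neg_left, neg_neg] at h1
  have h2 := norm_rpow_add_mul_integral_inner_le hp G K
  rw [h1] at h2
  have h3 : inner ℝ w (u - v) = -inner ℝ w (v - u) := by rw [← inner_neg_right, neg_sub]
  have h4 := mul_le_mul_of_nonneg_left h2 (show 0 ≤ 1 / p by positivity)
  rw [mul_add, ← mul_assoc, one_div_mul_cancel hp0.ne', one_mul] at h4
  rw [h3]
  linarith

theorem inner_le_of_mem_subdifferential (hp : 1 < p) {u w v : L2 d} {G K : LpField d p}
    (hw : w ∈ subdifferential (potential d p) u) (hG : HasWeakGradient u G)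
    (hK : HasWeakGradient v K) :
    inner ℝ w v ≤ ∫ x, inner ℝ (‖G x‖ ^ (p - 2) • G x) (K x) := by
  have hp0 : 0 < p := by linarith
  have hlim := tendsto_integral_inner_norm_rpow_sub_two_smul hp G K
    (tendsto_one_div_add_atTop_nhds_zero_nat (𝕜 := ℝ)) (fun n => by
      rw [abs_of_pos Nat.one_div_pos_of_nat]
      simpa using Nat.one_div_le_one_div (α := ℝ) (Nat.zero_le n))
  refine ge_of_tendsto hlim (.of_forall fun n => ?_)
  set t : ℝ := 1 / ((n : ℝ) + 1) with ht
  have ht0 : 0 < t := Nat.one_div_pos_of_nat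
  have hgr : HasWeakGradient ⇑(u + t • v) ⇑(G + t • K) := by
    have := hG.lp_linear_combination 1 t hK
    rwa [one_smul, one_smul] at this
  have h1 := hw (u + t • v)
  rw [potential_eq hp hG, potential_eq hp hgr, ← EReal.coe_add, EReal.coe_le_coe_iff,
    sub_add_cancel_left, inner_neg_right, real_inner_smul_right] at h1
  -- Convexity is used at the moved point `G + t K`, looking back to `G`: this bounds the difference
  -- quotient from above, as needed.
  have h2 := norm_rpow_add_mul_integral_inner_le hp (G + t • K) G
  have h3 : ∫ x, inner ℝ (‖(G + t • K) x‖ ^ (p - 2) • (G + t • K) x) ((G - (G + t • K)) x) =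
      -(t * ∫ x, inner ℝ (‖(G + t • K) x‖ ^ (p - 2) • (G + t • K) x) (K x)) := by
    rw [← integral_const_mul, ← integral_neg]
    refine integral_congr_ae ?_
    rw [sub_add_cancel_left]
    filter_upwards [Lp.coeFn_neg (t • K), Lp.coeFn_smul t K] with x hx1 hx2
    rw [hx1, Pi.neg_apply, hx2, Pi.smul_apply, inner_neg_right, real_inner_smul_right]
  rw [h3] at h2
  have h4 := mul_le_mul_of_nonneg_left h2 (show 0 ≤ 1 / p by positivity)
  rw [mul_add, ← mul_assoc, one_div_mul_cancel hp0.ne', one_mul] at h4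
  exact le_of_mul_le_mul_left (by linarith) ht0

/-- The one-sided bound of `inner_le_of_mem_subdifferential` for `φ` and `-φ` becomes an equality,
which is the definition of the weak divergence. -/
theorem subdifferential_subset_pLaplaceOp [Fact (1 ≤ ENNReal.ofReal p)] (hp : 1 < p) (u : L2 d) :
    subdifferential (potential d p) u ⊆ pLaplaceOp d p u := by
  intro w hw
  have := holderConjugate_ofReal hp
  obtain ⟨G, hG⟩ := exists_lp_of_potential_ne_top
    (ne_top_of_mem_subdifferential ⟨0, potential_zero_ne_top hp⟩ hw)
  rw [mem_pLaplaceOp_iff_of_hasWeakGradient hG]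
  have hF := memLp_norm_rpow_sub_two_smul hp G
  refine ⟨hF.locallyIntegrable (ENNReal.HolderConjugate.one_le _ (ENNReal.ofReal p)),
    (Lp.memLp (-w)).locallyIntegrable one_le_two, fun φ hφ hφs => ?_⟩
  have hv : MemLp φ 2 volume := hφ.continuous.memLp_of_hasCompactSupport hφs
  have hk : MemLp (∇ φ) (ENNReal.ofReal p) volume :=
    (continuous_gradient hφ).memLp_of_hasCompactSupport (hasCompactSupport_gradient hφs)
  have hK : HasWeakGradient (hv.toLp φ) (hk.toLp (∇ φ)) :=
    (hasWeakGradient_of_contDiff hφ).congr hv.coeFn_toLp.symm hk.coeFn_toLp.symm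
  have hK' : HasWeakGradient ⇑(-hv.toLp φ) ⇑(-hk.toLp (∇ φ)) := by
    have := hK.lp_linear_combination (-1) 0 hK
    rwa [zero_smul, zero_smul, add_zero, add_zero, neg_one_smul, neg_one_smul] at this
  have h1 := inner_le_of_mem_subdifferential hp hw hG hK
  have h2 := inner_le_of_mem_subdifferential hp hw hG hK'
  have h3 : ∫ x, inner ℝ (‖G x‖ ^ (p - 2) • G x) ((-hk.toLp (∇ φ) : LpField d p) x) =
      -∫ x, inner ℝ (‖G x‖ ^ (p - 2) • G x) (hk.toLp (∇ φ) x) := by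
    rw [← integral_neg]
    refine integral_congr_ae ((Lp.coeFn_neg (hk.toLp (∇ φ))).mono fun x hx => ?_)
    simp only [hx, Pi.neg_apply, inner_neg_right]
  rw [h3, inner_neg_right] at h2
  have h4 := le_antisymm (neg_le_neg_iff.1 h2) h1
  have h5 : ∫ x, inner ℝ (‖G x‖ ^ (p - 2) • G x) (hk.toLp (∇ φ) x) =
      ∫ x, inner ℝ (‖G x‖ ^ (p - 2) • G x) (∇ φ x) :=
    integral_congr_ae (hk.coeFn_toLp.mono fun x hx => by simp only [hx])
  have h6 : inner ℝ w (hv.toLp φ) = -∫ x, φ x • (-w : L2 d) x := by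
    rw [L2.inner_def, ← integral_neg]
    refine integral_congr_ae ?_
    filter_upwards [hv.coeFn_toLp, Lp.coeFn_neg w] with x hx1 hx2
    simp only [hx1, hx2, Pi.neg_apply, smul_eq_mul, mul_neg, neg_neg]
    simp
  rw [← h5, h4, h6]

theorem pLaplaceOp_eq_subdifferential [Fact (1 ≤ ENNReal.ofReal p)] (hp : 1 < p) :
    pLaplaceOp d p = subdifferential (potential d p) :=
  funext fun u => Set.Subset.antisymm (pLaplaceOp_subset_subdifferential hp u)
    (subdifferential_subset_pLaplaceOp hp u)

end Subdifferential

end PLaplace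

end

theorem proposition2p1 (d : ℕ) (hd : 1 ≤ d) (p : ℝ) (hp : 1 < p) :
    PLaplace.IsMaximalMonotone (PLaplace.pLaplaceOp d p) ∧
    PLaplace.IsMAccretive (PLaplace.pLaplaceOp d p) ∧
    (∀ u : PLaplace.L2 d, ⊥ < PLaplace.potential d p u) ∧
    PLaplace.IsConvex (PLaplace.potential d p) ∧
    LowerSemicontinuous (PLaplace.potential d p) ∧
    PLaplace.pLaplaceOp d p = PLaplace.subdifferential (PLaplace.potential d p) := by
  have : Fact (1 ≤ ENNReal.ofReal p) := ⟨ENNReal.one_le_ofReal.2 hp.le⟩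
  have hnonneg := PLaplace.potential_nonneg (d := d) hp
  have htop : ∃ u, PLaplace.potential d p u ≠ ⊤ := ⟨0, PLaplace.potential_zero_ne_top hp⟩
  have hconv := PLaplace.potential_isConvex (d := d) hp
  have hlsc := PLaplace.potential_lowerSemicontinuous (d := d) hp
  have heq := PLaplace.pLaplaceOp_eq_subdifferential (d := d) hp
  have hacc : PLaplace.IsMAccretive (PLaplace.pLaplaceOp d p) := by
    rw [heq]
    exact ⟨PLaplace.subdifferential_isMonotone
        (fun u => ne_bot_of_le_ne_bot EReal.zero_ne_bot (hnonneg u)) htop,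
      fun lam hlam f =>
        PLaplace.exists_mem_subdifferential_add_smul_eq hnonneg htop hconv hlsc hlam f⟩
  exact ⟨hacc.isMaximalMonotone, hacc, fun u => EReal.bot_lt_zero.trans_le (hnonneg u), hconv,
    hlsc, heq⟩
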